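/- Let $p,q\in\mathbb C$ with $0<|p|<1$ and $0<|q|<1$. Put $(a;q)_\infty=\prod_{n=0}^\infty(1-aq^n)$ and let $$\Gamma(z;p,q)=\prod_{j,k=0}^\infty\frac{1-z^{-1}p^{j+1}q^{k+1}}{1-zp^jq^k},\qquad z\in\mathbb C\setminus\{0\},$$ be the standard elliptic gamma function. Let $t_1,\ldots,t_6\in\mathbb C$ satisfy $|t_j|<1$ for all $j$ and $\prod_{j=1}^6t_j=pq$. Then the following integral exists and $$\kappa\int_{\mathbb T}\frac{\prod_{k=1}^6\Gamma(t_kz;p,q)\,\Gamma(t_kz^{-1};p,q)}{\Gamma(z^2;p,q)\,\Gamma(z^{-2};p,q)}\,\frac{dz}{z}=\prod_{1\le j<k\le 6}\Gamma(t_jt_k;p,q),\qquad \kappa=\frac{(p;p)_\infty(q;q)_\infty}{4\pi i},$$ where $\mathbb T$ is the positively oriented unit circle $|z|=1$, and $1/\Gamma(z;p,q)$ is understood to be $0$ at the poles $z=p^{-j}q^{-k}$ ($j,k\ge 0$) of $\Gamma(\,\cdot\,;p,q)$. -/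

import Mathlib

/-- The infinite `q`-Pochhammer symbol `(a; q)_∞ = ∏_{n ≥ 0} (1 - a q ^ n)`, for `|q| < 1`. -/
noncomputable def qPochInf (a q : ℂ) : ℂ :=
  ∏' n : ℕ, (1 - a * q ^ n)

/-- The standard elliptic gamma function
`Γ(z; p, q) = ∏_{j, k ≥ 0} (1 - z⁻¹ p ^ (j + 1) q ^ (k + 1)) / (1 - z p ^ j q ^ k)`,
for `|p|, |q| < 1` and `z ≠ 0`.
At a pole `z = p ^ (-j) q ^ (-k)` one of the factors is a division by zero, which is `0` in Lean, so
that the value there is `0`, and its reciprocal is `0`, in agreement with the analytic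
function `1 / Γ(z; p, q)`. -/
noncomputable def ellGamma (z p q : ℂ) : ℂ :=
  ∏' jk : ℕ × ℕ,
    (1 - z⁻¹ * p ^ (jk.1 + 1) * q ^ (jk.2 + 1)) / (1 - z * p ^ jk.1 * q ^ jk.2)

/-- The integrand
`∏_{k=1}^6 Γ(t_k z; p, q) Γ(t_k z⁻¹; p, q) / (Γ(z ^ 2; p, q) Γ(z ^ (-2); p, q))`
of the elliptic beta integral, taken with respect to `dz / z`. -/
noncomputable def ellBetaIntegrand (t : Fin 6 → ℂ) (p q z : ℂ) : ℂ :=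
  (∏ k : Fin 6, ellGamma (t k * z) p q * ellGamma (t k * z⁻¹) p q) /
    (ellGamma (z ^ 2) p q * ellGamma (z ^ (-2 : ℤ)) p q)

/-- The normalizing constant `κ = (q; q)_∞ (p; p)_∞ / (4 π i)`. -/
noncomputable def ellBetaKappa (p q : ℂ) : ℂ :=
  qPochInf q q * qPochInf p p / (4 * (Real.pi : ℂ) * Complex.I)

/-! Let R(t) (`betaRatio`) be the mean value of the integrand over the unit circle divided by the
product of the Γ(t_j t_k). The claim is that R is the constant 2 / ((p;p)_∞ (q;q)_∞).

R is invariant under moving a factor q from one parameter to another (`betaRatio_shift`). After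
multiplication by suitable theta products, the difference of the two integrands is a multiple of
K(z) + K(1/z), with K the `shiftKernel`; pointwise this is a theta function identity
(`qTheta_six_term`). Moreover K(z/q) = -K(1/z), and K is holomorphic for 1 ≤ |z| ≤ 1/|q|, so its
mean value equals its own negative and vanishes.

Fix all parameters but two, s and c/s. Then R is holomorphic in s on |c| < |s| < 1 and invariant
under s ↦ qs. If |c| < |q|, this annulus contains a closed fundamental domain with room to spare, so
the maximum principle makes R constant on |q| ≤ |s| < 1 (`betaRatio_slice`). Two such moves bring
two parameters to ±iρ.

As ρ → 1, poles pinch the circle at z = ±i. The singular factors form, up to the scalar 1 - ρ^4, a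
Poisson kernel in z², while Γ(ρ²) in the denominator blows up at the same rate; comparing the two
gives the constant (`tendsto_betaRatio_pinched`). Since R does not depend on ρ, it equals this limit
on an open set of parameters, and the identity theorem along a path in logarithmic coordinates
reaches every admissible t (`betaRatio_eq`). -/

open Filter Topology Real

/-! ### Convergent products as entire functions. -/

section EntireProduct

variable {ι : Type*} {w : ι → ℂ}

theorem multipliable_one_sub_mul (hw : Summable fun i => ‖w i‖) (z : ℂ) :
    Multipliable fun i => 1 - z * w i := by
  have : Multipliable fun i => 1 + (-(z * w i)) :=
    multipliable_one_add_of_summable (by simpa using hw.mul_left ‖z‖)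
  simpa [sub_eq_add_neg] using this

theorem tprod_one_sub_mul_ne_zero (hw : Summable fun i => ‖w i‖) {z : ℂ}
    (hz : ∀ i, 1 - z * w i ≠ 0) : ∏' i, (1 - z * w i) ≠ 0 := by
  have := tprod_one_add_ne_zero_of_summable (f := fun i => -(z * w i))
    (fun i => by simpa [sub_eq_add_neg] using hz i) (by simpa using hw.mul_left ‖z‖)
  simpa [sub_eq_add_neg] using this

theorem differentiable_tprod_one_sub_mul (hw : Summable fun i => ‖w i‖) :
    Differentiable ℂ fun z => ∏' i, (1 - z * w i) := by
  intro z
  have h := (hw.mul_left (‖z‖ + 1)).hasProdLocallyUniformlyOn_one_add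
    (K := Metric.ball (0 : ℂ) (‖z‖ + 1)) (f := fun i x => -(x * w i)) Metric.isOpen_ball
    (.of_forall fun i x hx => by
      rw [norm_neg, norm_mul]
      gcongr
      simpa using (mem_ball_zero_iff.1 hx).le) (fun i => by fun_prop)
  have hd : DifferentiableOn ℂ (fun x => ∏' i, (1 + -(x * w i))) (Metric.ball 0 (‖z‖ + 1)) :=
    h.differentiableOn (.of_forall fun _ => by
      simpa [Finset.prod_fn] using DifferentiableOn.finsetProd (fun _ _ => by fun_prop))
      Metric.isOpen_ball
  have := hd.differentiableAt (Metric.isOpen_ball.mem_nhds (x := z) (by simp))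
  simpa [sub_eq_add_neg] using this

end EntireProduct

/-! ### Pochhammer symbols in one base. -/

section QPoch

variable {q : ℂ}

theorem summable_norm_pow_of_norm_lt_one (hq : ‖q‖ < 1) : Summable fun n : ℕ => ‖q ^ n‖ := by
  simpa using summable_geometric_of_lt_one (norm_nonneg q) hq

theorem one_sub_ne_zero_of_norm_lt_one {x : ℂ} (hx : ‖x‖ < 1) : 1 - x ≠ 0 := by
  intro h
  rw [sub_eq_zero] at h
  simp [← h] at hx

theorem differentiable_qPochInf (hq : ‖q‖ < 1) : Differentiable ℂ fun a => qPochInf a q :=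
  differentiable_tprod_one_sub_mul (summable_norm_pow_of_norm_lt_one hq)

theorem qPochInf_ne_zero_of_forall (hq : ‖q‖ < 1) {a : ℂ} (ha : ∀ n : ℕ, 1 - a * q ^ n ≠ 0) :
    qPochInf a q ≠ 0 :=
  tprod_one_sub_mul_ne_zero (summable_norm_pow_of_norm_lt_one hq) ha

theorem norm_mul_pow_le (hq : ‖q‖ < 1) (a : ℂ) (n : ℕ) : ‖a * q ^ n‖ ≤ ‖a‖ := by
  rw [norm_mul, norm_pow]
  exact mul_le_of_le_one_right (norm_nonneg _) (pow_le_one₀ (norm_nonneg _) hq.le)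

theorem qPochInf_ne_zero (hq : ‖q‖ < 1) {a : ℂ} (ha : ‖a‖ < 1) : qPochInf a q ≠ 0 :=
  qPochInf_ne_zero_of_forall hq fun n =>
    one_sub_ne_zero_of_norm_lt_one ((norm_mul_pow_le hq a n).trans_lt ha)

theorem qPochInf_eq_mul (hq : ‖q‖ < 1) (a : ℂ) :
    qPochInf a q = (1 - a) * qPochInf (q * a) q := by
  have h := multipliable_one_sub_mul (summable_norm_pow_of_norm_lt_one hq) (q * a)
  have h2 : Multipliable fun n : ℕ => 1 - a * q ^ (n + 1) := by
    refine h.congr fun n => ?_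
    ring
  unfold qPochInf
  rw [tprod_eq_zero_mul' (f := fun n : ℕ => 1 - a * q ^ n) h2, pow_zero, mul_one]
  congr 1
  exact tprod_congr fun n => by ring

theorem qPochInf_one (hq : ‖q‖ < 1) : qPochInf 1 q = 0 := by
  rw [qPochInf_eq_mul hq]; simp

/-- `1 - a` divides out of a nonvanishing Pochhammer symbol: for `‖a‖ < ‖q‖⁻¹`, `a ≠ 1`. -/
theorem qPochInf_ne_zero_of_ne_one (hq : ‖q‖ < 1) {a : ℂ} (ha : a ≠ 1) (ha' : ‖q * a‖ < 1) :
    qPochInf a q ≠ 0 := by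
  rw [qPochInf_eq_mul hq]
  exact mul_ne_zero (sub_ne_zero.2 ha.symm) (qPochInf_ne_zero hq ha')

end QPoch

/-! ### Double Pochhammer products and the elliptic gamma function. -/

/-- The entire function `∏_{j, k ≥ 0} (1 - z p ^ j q ^ k)`. -/
noncomputable def dblPoch (p q z : ℂ) : ℂ :=
  ∏' jk : ℕ × ℕ, (1 - z * (p ^ jk.1 * q ^ jk.2))

section DblPoch

variable {p q : ℂ}

theorem summable_norm_pow_mul_pow (hp : ‖p‖ < 1) (hq : ‖q‖ < 1) :
    Summable fun jk : ℕ × ℕ => ‖p ^ jk.1 * q ^ jk.2‖ := by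
  simpa using (summable_norm_pow_of_norm_lt_one hp).mul_of_nonneg
    (summable_norm_pow_of_norm_lt_one hq) (fun _ => norm_nonneg _) (fun _ => norm_nonneg _)

theorem multipliable_dblPoch (hp : ‖p‖ < 1) (hq : ‖q‖ < 1) (z : ℂ) :
    Multipliable fun jk : ℕ × ℕ => 1 - z * (p ^ jk.1 * q ^ jk.2) :=
  multipliable_one_sub_mul (summable_norm_pow_mul_pow hp hq) z

theorem differentiable_dblPoch (hp : ‖p‖ < 1) (hq : ‖q‖ < 1) : Differentiable ℂ (dblPoch p q) :=
  differentiable_tprod_one_sub_mul (summable_norm_pow_mul_pow hp hq)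

theorem dblPoch_ne_zero (hp : ‖p‖ < 1) (hq : ‖q‖ < 1) {z : ℂ} (hz : ‖z‖ < 1) :
    dblPoch p q z ≠ 0 := by
  refine tprod_one_sub_mul_ne_zero (summable_norm_pow_mul_pow hp hq) fun i =>
    one_sub_ne_zero_of_norm_lt_one ?_
  rw [← mul_assoc]
  exact ((norm_mul_pow_le hq _ _).trans (norm_mul_pow_le hp _ _)).trans_lt hz

theorem dblPoch_comm (z : ℂ) : dblPoch p q z = dblPoch q p z := by
  unfold dblPoch
  rw [← (Equiv.prodComm ℕ ℕ).tprod_eq]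
  exact tprod_congr fun x => by simp [mul_comm]

theorem hasProd_qPochInf_dblPoch (hp : ‖p‖ < 1) (hq : ‖q‖ < 1) (z : ℂ) :
    HasProd (fun j : ℕ => qPochInf (z * p ^ j) q) (dblPoch p q z) := by
  refine (multipliable_dblPoch hp hq z).hasProd.prod_fiberwise fun j => ?_
  have := (multipliable_one_sub_mul (summable_norm_pow_of_norm_lt_one hq) (z * p ^ j)).hasProd
  simpa only [qPochInf, mul_assoc] using this

theorem dblPoch_eq_mul_right (hp : ‖p‖ < 1) (hq : ‖q‖ < 1) (z : ℂ) :
    dblPoch p q z = qPochInf z p * dblPoch p q (q * z) := by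
  have h1 : HasProd (fun j : ℕ => 1 - z * p ^ j) (qPochInf z p) :=
    (multipliable_one_sub_mul (summable_norm_pow_of_norm_lt_one hp) z).hasProd
  have h2 := h1.mul (hasProd_qPochInf_dblPoch hp hq (q * z))
  refine (hasProd_qPochInf_dblPoch hp hq z).unique ?_
  convert h2 using 1
  funext j
  rw [qPochInf_eq_mul hq, mul_assoc q]

theorem dblPoch_eq_mul_left (hp : ‖p‖ < 1) (hq : ‖q‖ < 1) (z : ℂ) :
    dblPoch p q z = qPochInf z q * dblPoch p q (p * z) := by
  rw [dblPoch_comm, dblPoch_eq_mul_right hq hp, dblPoch_comm]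

theorem ellGamma_eq (hp : ‖p‖ < 1) (hq : ‖q‖ < 1) (z : ℂ) :
    ellGamma z p q = dblPoch p q (p * q / z) / dblPoch p q z := by
  have hn := (multipliable_dblPoch hp hq (p * q / z)).hasProd
  have hd := (multipliable_dblPoch hp hq z).hasProd
  have hf : (fun jk : ℕ × ℕ => (1 - z⁻¹ * p ^ (jk.1 + 1) * q ^ (jk.2 + 1)) /
      (1 - z * p ^ jk.1 * q ^ jk.2)) = fun jk : ℕ × ℕ =>
      (1 - p * q / z * (p ^ jk.1 * q ^ jk.2)) / (1 - z * (p ^ jk.1 * q ^ jk.2)) := by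
    funext jk
    congr 2 <;> ring
  unfold ellGamma
  rw [hf]
  -- At a pole some factor of the defining product is a division by zero, so the whole product is
  -- `0`, matching the value of the quotient.
  by_cases h0 : dblPoch p q z = 0
  · rw [h0, div_zero]
    refine (hasProd_zero_of_exists_eq_zero ?_).tprod_eq
    by_contra! hne
    refine tprod_one_sub_mul_ne_zero (summable_norm_pow_mul_pow hp hq) (fun i hi => ?_) h0
    exact hne i (by rw [hi, div_zero])
  · exact (hn.div₀ hd h0).tprod_eq

theorem differentiableAt_ellGamma (hp : ‖p‖ < 1) (hq : ‖q‖ < 1) {z : ℂ} (h0 : z ≠ 0)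
    (hz : ‖z‖ < 1) : DifferentiableAt ℂ (fun x => ellGamma x p q) z := by
  have hE := differentiable_dblPoch hp hq
  simp only [ellGamma_eq hp hq]
  refine DifferentiableAt.div ?_ (hE z) (dblPoch_ne_zero hp hq hz)
  exact (hE _).comp z (by fun_prop (disch := assumption))

theorem ellGamma_ne_zero (hp : ‖p‖ < 1) (hq : ‖q‖ < 1) {z : ℂ} (hz : ‖z‖ < 1)
    (hz' : ‖p * q / z‖ < 1) : ellGamma z p q ≠ 0 := by
  rw [ellGamma_eq hp hq]
  exact div_ne_zero (dblPoch_ne_zero hp hq hz') (dblPoch_ne_zero hp hq hz)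

theorem ellGamma_mul_ellGamma_div (hp : ‖p‖ < 1) (hq : ‖q‖ < 1) (hp0 : p ≠ 0) (hq0 : q ≠ 0)
    {z : ℂ} (hz : ‖z‖ < 1) (hz' : ‖p * q / z‖ < 1) :
    ellGamma z p q * ellGamma (p * q / z) p q = 1 := by
  have h1 := dblPoch_ne_zero hp hq hz'
  have h2 := dblPoch_ne_zero hp hq hz
  rw [ellGamma_eq hp hq, ellGamma_eq hp hq, div_div_cancel₀ (mul_ne_zero hp0 hq0)]
  field_simp

end DblPoch

/-! ### Theta functions and their link with the elliptic gamma function. -/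

/-- The theta function `θ(x; p) = (x; p)_∞ (p / x; p)_∞`. -/
noncomputable def qTheta (p x : ℂ) : ℂ := qPochInf x p * qPochInf (p / x) p

section Theta

variable {p q : ℂ}

theorem differentiableAt_qTheta (hp : ‖p‖ < 1) {x : ℂ} (hx : x ≠ 0) :
    DifferentiableAt ℂ (qTheta p) x := by
  have h := differentiable_qPochInf hp
  exact (h x).mul ((h _).comp x (f := fun x => p / x) (by fun_prop (disch := assumption)))

theorem qTheta_div (hp0 : p ≠ 0) (x : ℂ) : qTheta p (p / x) = qTheta p x := by
  unfold qTheta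
  rw [div_div_cancel₀ hp0, mul_comm]

theorem qTheta_one (hp : ‖p‖ < 1) : qTheta p 1 = 0 := by
  rw [qTheta, qPochInf_one hp, zero_mul]

theorem qTheta_mul (hp : ‖p‖ < 1) (hp0 : p ≠ 0) {x : ℂ} (hx : x ≠ 0) :
    qTheta p (p * x) = -x⁻¹ * qTheta p x := by
  unfold qTheta
  have h1 : p / (p * x) = x⁻¹ := by field_simp
  rw [h1, qPochInf_eq_mul hp x, qPochInf_eq_mul hp x⁻¹, ← div_eq_mul_inv]
  field_simp
  ring

theorem qTheta_inv (hp : ‖p‖ < 1) (hp0 : p ≠ 0) {x : ℂ} (hx : x ≠ 0) :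
    qTheta p x⁻¹ = -x⁻¹ * qTheta p x := by
  rw [← qTheta_mul hp hp0 hx, ← qTheta_div hp0]
  congr 1
  field_simp

theorem qTheta_ne_zero (hp : ‖p‖ < 1) {x : ℂ} (h1 : x ≠ 1) (hx : ‖p * x‖ < 1)
    (hx' : ‖p / x‖ < 1) : qTheta p x ≠ 0 :=
  mul_ne_zero (qPochInf_ne_zero_of_ne_one hp h1 hx) (qPochInf_ne_zero hp hx')

theorem ellGamma_mul_left (hp : ‖p‖ < 1) (hq : ‖q‖ < 1) (hp0 : p ≠ 0) (hq0 : q ≠ 0) {x : ℂ}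
    (hx0 : x ≠ 0) (hx : ‖x‖ < 1) : ellGamma (q * x) p q = qTheta p x * ellGamma x p q := by
  have hqx : ‖q * x‖ < 1 := by
    rw [norm_mul]; exact mul_lt_one_of_nonneg_of_lt_one_left (norm_nonneg _) hq hx.le
  have h1 := dblPoch_ne_zero hp hq hx
  have h2 := dblPoch_ne_zero hp hq hqx
  rw [ellGamma_eq hp hq, ellGamma_eq hp hq, show p * q / (q * x) = p / x by field_simp,
    dblPoch_eq_mul_right hp hq (p / x), show q * (p / x) = p * q / x by ring, qTheta]
  rw [div_eq_iff h2, dblPoch_eq_mul_right hp hq x] at *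
  have h3 : qPochInf x p ≠ 0 := left_ne_zero_of_mul h1
  generalize dblPoch p q (q * x) = e at *
  field_simp

/-- Peeling one row and one column off the double product at x leaves its value at pqx, which
cancels the numerator of Γ(1/x); symmetrically for 1/x. Only nonvanishing factors are cancelled, so
the pole x = 1 is covered, with both sides `0`. -/
theorem inv_ellGamma_mul_ellGamma_inv (hp : ‖p‖ < 1) (hq : ‖q‖ < 1)
    {x : ℂ} (hx : ‖x‖ = 1) :
    (ellGamma x p q * ellGamma x⁻¹ p q)⁻¹ = qTheta p x * qTheta q x⁻¹ := by
  have hpq : ‖p * q‖ < 1 := by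
    rw [norm_mul]; exact mul_lt_one_of_nonneg_of_lt_one_left (norm_nonneg _) hp hq.le
  have h1 : dblPoch p q (p * q * x) ≠ 0 := dblPoch_ne_zero hp hq (by simpa [hx] using hpq)
  have h2 : dblPoch p q (p * q / x) ≠ 0 := dblPoch_ne_zero hp hq (by simpa [hx] using hpq)
  have e1 : dblPoch p q x = qPochInf x p * (qPochInf (q * x) q * dblPoch p q (p * q * x)) := by
    rw [dblPoch_eq_mul_right hp hq, dblPoch_eq_mul_left hp hq (q * x), mul_assoc]
  have e2 : dblPoch p q x⁻¹ =
      qPochInf x⁻¹ q * (qPochInf (p / x) p * dblPoch p q (p * q / x)) := by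
    rw [dblPoch_eq_mul_left hp hq, dblPoch_eq_mul_right hp hq (p * x⁻¹), div_eq_mul_inv,
      div_eq_mul_inv]
    ring_nf
  rw [ellGamma_eq hp hq, ellGamma_eq hp hq, e1, e2, div_inv_eq_mul, qTheta, qTheta,
    div_inv_eq_mul, mul_inv, inv_div, inv_div]
  generalize dblPoch p q (p * q * x) = e at *
  generalize dblPoch p q (p * q / x) = e' at *
  field_simp

end Theta

/-! ### Mean values over circles: rotation, change of radius, Fourier uniqueness. -/

section CircleAverage

theorem circleAverage_comp_mul {f : ℂ → ℂ} (c : ℂ) (r : ℝ) :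
    circleAverage (fun z => f (c * z)) 0 r = circleAverage f 0 (‖c‖ * r) := by
  symm
  -- The modulus of c rescales the radius; its argument only translates the angle, which a full
  -- period does not see.
  rw [circleAverage_eq_integral_add c.arg, circleAverage]
  congr 2
  funext θ
  congr 1
  simp only [circleMap, zero_add, Complex.ofReal_mul, Complex.ofReal_add, add_mul, Complex.exp_add]
  linear_combination (r : ℂ) * Complex.exp (θ * Complex.I) * Complex.norm_mul_exp_arg_mul_I c

theorem circleAverage_eq_of_differentiableAt_annulus {f : ℂ → ℂ} {r R : ℝ} (h0 : 0 < r)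
    (hle : r ≤ R) (hf : ∀ z, r ≤ ‖z‖ → ‖z‖ ≤ R → DifferentiableAt ℂ f z) :
    circleAverage f 0 R = circleAverage f 0 r := by
  rw [circleAverage_eq_circleIntegral (h0.trans_le hle).ne', circleAverage_eq_circleIntegral h0.ne']
  congr 1
  refine Complex.circleIntegral_sub_center_inv_smul_eq_of_differentiable_on_annulus_off_countable
    h0 hle Set.countable_empty (fun z hz => ?_) (fun z hz => ?_)
  · simp only [Set.mem_sdiff, mem_closedBall_zero_iff, mem_ball_zero_iff, not_lt] at hz
    exact (hf z hz.2 hz.1).continuousAt.continuousWithinAt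
  · simp only [Set.mem_sdiff, mem_closedBall_zero_iff, mem_ball_zero_iff, not_le,
      Set.mem_empty_iff_false, not_false_eq_true, and_true] at hz
    exact hf z hz.2.le hz.1.le

/-- A continuous function on a circle all of whose Fourier coefficients vanish is zero. -/
theorem eq_zero_of_forall_circleAverage_zpow_mul_eq_zero {f : ℂ → ℂ} {r : ℝ} (hr : 0 < r)
    (hf : ContinuousOn f (Metric.sphere 0 r))
    (h : ∀ n : ℤ, circleAverage (fun z => z ^ n * f z) 0 r = 0) {x : ℂ} (hx : ‖x‖ = r) :
    f x = 0 := by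
  have : Fact (0 < 2 * π) := ⟨two_pi_pos⟩
  let g : C(AddCircle (2 * π), ℂ) :=
    ⟨fun y => f (r * AddCircle.toCircle y), by
      refine hf.comp_continuous (by fun_prop) fun y => ?_
      rw [mem_sphere_zero_iff_norm, norm_mul, Circle.norm_coe, Complex.norm_real, mul_one,
        norm_of_nonneg hr.le]⟩
  have hcoe : ∀ θ : ℝ, ((r : ℂ) * AddCircle.toCircle (θ : AddCircle (2 * π))) =
      circleMap 0 r θ := by
    intro θ
    rw [AddCircle.toCircle_apply_mk, Circle.coe_exp, circleMap, zero_add]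
    congr 2
    simp
  have hcoeff : ∀ n : ℤ, fourierCoeff g n = 0 := by
    intro n
    rw [fourierCoeff_eq_intervalIntegral _ _ 0]
    have h1 := h (-n)
    rw [circleAverage, smul_eq_zero] at h1
    have h2 := h1.resolve_left (by positivity)
    have h3 : ∀ θ : ℝ, (fourier (-n) (θ : AddCircle (2 * π)) : ℂ) • g θ =
        (r : ℂ) ^ n * (circleMap 0 r θ ^ (-n) * f (circleMap 0 r θ)) := by
      intro θ
      have : g θ = f (circleMap 0 r θ) := by rw [← hcoe]; rfl
      have hr' : (r : ℂ) ≠ 0 := by exact_mod_cast hr.ne'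
      rw [this, ← hcoe, fourier_apply, AddCircle.toCircle_zsmul, mul_zpow, smul_eq_mul,
        Circle.coe_zpow, ← mul_assoc, ← mul_assoc, ← zpow_add₀ hr']
      simp
    simp_rw [h3, zero_add]
    rw [intervalIntegral.integral_const_mul, h2]
    simp
  have hs := has_pointwise_sum_fourier_series_of_summable (f := g)
    (by simp only [funext hcoeff]; exact summable_zero) (x.arg : AddCircle (2 * π))
  have hg : g (x.arg : AddCircle (2 * π)) = f x := by
    change f (r * AddCircle.toCircle (x.arg : AddCircle (2 * π))) = f x
    rw [hcoe, circleMap, zero_add, ← hx, Complex.norm_mul_exp_arg_mul_I]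
  simp only [hcoeff, zero_smul] at hs
  rw [← hg]
  exact hs.unique hasSum_zero

end CircleAverage

/-! ### Theta functions of degree two form a space of dimension at most two. -/

section DegreeTwo

/-- Holomorphic functions on `ℂ \ {0}` with the quasi-periodicity `F (p x) = k x⁻² F x`. -/
structure IsDegreeTwo (p k : ℂ) (F : ℂ → ℂ) : Prop where
  differentiableAt : ∀ x, x ≠ 0 → DifferentiableAt ℂ F x
  map_mul : ∀ x, x ≠ 0 → F (p * x) = k * x ^ (-2 : ℤ) * F x

variable {p k : ℂ} {F G H : ℂ → ℂ}

theorem IsDegreeTwo.add (hF : IsDegreeTwo p k F) (hG : IsDegreeTwo p k G) :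
    IsDegreeTwo p k fun x => F x + G x :=
  ⟨fun x hx => (hF.1 x hx).add (hG.1 x hx), fun x hx => by
    rw [hF.2 x hx, hG.2 x hx]; ring⟩

theorem IsDegreeTwo.const_mul (hF : IsDegreeTwo p k F) (c : ℂ) :
    IsDegreeTwo p k fun x => c * F x :=
  ⟨fun x hx => (hF.1 x hx).const_mul c, fun x hx => by rw [hF.2 x hx]; ring⟩

/-- Moving the contour to |z| = |p| and substituting z ↦ pz turns quasi-periodicity into a two-step
recursion for the Laurent coefficients. -/
theorem IsDegreeTwo.circleAverage_zpow (hp : ‖p‖ < 1) (hp0 : p ≠ 0) (hF : IsDegreeTwo p k F)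
    (n : ℤ) : circleAverage (fun z => z ^ n * F z) 0 1 =
      p ^ n * k * circleAverage (fun z => z ^ (n - 2) * F z) 0 1 := by
  have hd : ∀ z, z ≠ 0 → DifferentiableAt ℂ (fun z => z ^ n * F z) z := fun z hz =>
    (differentiableAt_zpow.2 (Or.inl hz)).mul (hF.1 z hz)
  have hpp : 0 < ‖p‖ := norm_pos_iff.2 hp0
  rw [circleAverage_eq_of_differentiableAt_annulus hpp hp.le fun z hz _ =>
    hd z (norm_pos_iff.1 (hpp.trans_le hz))]
  have h1 := circleAverage_comp_mul (f := fun z => z ^ n * F z) p 1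
  rw [mul_one] at h1
  rw [← h1, ← smul_eq_mul (p ^ n * k), ← circleAverage_fun_smul]
  refine circleAverage_congr_sphere fun z hz => ?_
  have hz0 : z ≠ 0 := by
    rintro rfl
    simp at hz
  simp only [smul_eq_mul]
  rw [hF.2 z hz0, mul_zpow, sub_eq_add_neg, zpow_add₀ hz0]
  ring

/-- The recursion, run in both directions, determines all Laurent coefficients from two consecutive
ones. -/
theorem IsDegreeTwo.eq_zero (hp : ‖p‖ < 1) (hp0 : p ≠ 0) (hk : k ≠ 0) (hF : IsDegreeTwo p k F)
    (h0 : circleAverage F 0 1 = 0) (h1 : circleAverage (fun z => z * F z) 0 1 = 0) {x : ℂ}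
    (hx : x ≠ 0) : F x = 0 := by
  set a : ℤ → ℂ := fun n => circleAverage (fun z => z ^ n * F z) 0 1 with ha
  have hrec : ∀ n, a n = p ^ n * k * a (n - 2) := hF.circleAverage_zpow hp hp0
  have hpk : ∀ n : ℤ, p ^ n * k ≠ 0 := fun n => mul_ne_zero (zpow_ne_zero _ hp0) hk
  have hall : ∀ n, a n = 0 ∧ a (n + 1) = 0 := by
    intro n
    induction n using Int.induction_on with
    | zero => exact ⟨by simpa [ha] using h0, by simpa [ha] using h1⟩
    | succ n ih =>
      refine ⟨ih.2, ?_⟩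
      rw [hrec, show (n : ℤ) + 1 + 1 - 2 = n by ring, ih.1, mul_zero]
    | pred n ih =>
      refine ⟨?_, by rw [sub_add_cancel]; exact ih.1⟩
      have := hrec (-(n : ℤ) + 1)
      rw [ih.2, show -(n : ℤ) + 1 - 2 = -n - 1 by ring] at this
      exact (mul_eq_zero.1 this.symm).resolve_left (hpk _)
  have hdiff : ∀ n : ℤ, ∀ z, z ≠ 0 → DifferentiableAt ℂ (fun z => z ^ n * F z) z := fun n z hz =>
    (differentiableAt_zpow.2 (Or.inl hz)).mul (hF.1 z hz)
  have hxp : 0 < ‖x‖ := norm_pos_iff.2 hx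
  refine eq_zero_of_forall_circleAverage_zpow_mul_eq_zero hxp
    (fun z hz => (hF.1 z ?_).continuousAt.continuousWithinAt) (fun n => ?_) rfl
  · rintro rfl
    simp at hz
    exact hx (norm_eq_zero.1 hz.symm)
  -- F is holomorphic off the origin, so its moments on |z| = |x| are those on the unit circle.
  · refine Eq.trans ?_ (hall n).1
    rcases le_total ‖x‖ 1 with h | h
    · exact (circleAverage_eq_of_differentiableAt_annulus hxp h fun z hz _ =>
        hdiff n z (norm_pos_iff.1 (hxp.trans_le hz))).symm
    · exact circleAverage_eq_of_differentiableAt_annulus one_pos h fun z hz _ =>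
        hdiff n z (norm_pos_iff.1 (one_pos.trans_le hz))

theorem IsDegreeTwo.circleIntegrable (hF : IsDegreeTwo p k F) : CircleIntegrable F 0 1 :=
  ContinuousOn.circleIntegrable zero_le_one fun z hz =>
    (hF.1 z (by rintro rfl; simp at hz)).continuousAt.continuousWithinAt

/-- The space of functions of degree two has dimension at most two. -/
theorem IsDegreeTwo.exists_linear_relation (hp : ‖p‖ < 1) (hp0 : p ≠ 0) (hk : k ≠ 0)
    (hF : IsDegreeTwo p k F) (hG : IsDegreeTwo p k G) (hH : IsDegreeTwo p k H) :
    ∃ a b c : ℂ, (a ≠ 0 ∨ b ≠ 0 ∨ c ≠ 0) ∧ ∀ x, x ≠ 0 → a * F x + b * G x + c * H x = 0 := by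
  -- Three functions and only two determining moments: a 2 × 3 system has a nonzero solution.
  let A : Fin 3 → ℂ := ![circleAverage F 0 1, circleAverage G 0 1, circleAverage H 0 1]
  let B : Fin 3 → ℂ := ![circleAverage (fun z => z * F z) 0 1,
    circleAverage (fun z => z * G z) 0 1, circleAverage (fun z => z * H z) 0 1]
  let L : (Fin 3 → ℂ) →ₗ[ℂ] (Fin 2 → ℂ) := (Matrix.of ![A, B]).mulVecLin
  have hker : LinearMap.ker L ≠ ⊥ := LinearMap.ker_ne_bot_of_finrank_lt (by simp)
  obtain ⟨v, hv, hv0⟩ := (Submodule.ne_bot_iff _).1 hker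
  have hLv : L v = 0 := hv
  have e0 := congrFun hLv 0
  have e1 := congrFun hLv 1
  simp [L, A, B, Matrix.mulVec, dotProduct, Fin.sum_univ_three] at e0 e1
  refine ⟨v 0, v 1, v 2, ?_, ?_⟩
  · by_contra! hcon
    exact hv0 (funext fun i => by fin_cases i <;> simp [hcon])
  · have hmulInt : ∀ {F : ℂ → ℂ}, IsDegreeTwo p k F →
        CircleIntegrable (fun z => z * F z) 0 1 := fun hF =>
      ContinuousOn.circleIntegrable zero_le_one fun z hz =>
        (continuousAt_id.mul (hF.1 z (by rintro rfl; simp at hz)).continuousAt).continuousWithinAt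
    have hlin : ∀ {F G H : ℂ → ℂ}, CircleIntegrable F 0 1 → CircleIntegrable G 0 1 →
        CircleIntegrable H 0 1 → circleAverage (fun z => v 0 * F z + v 1 * G z + v 2 * H z) 0 1 =
        v 0 * circleAverage F 0 1 + v 1 * circleAverage G 0 1 + v 2 * circleAverage H 0 1 := by
      intro F G H hF hG hH
      have hF' := hF.const_smul (a := v 0)
      have hG' := hG.const_smul (a := v 1)
      have hH' := hH.const_smul (a := v 2)
      have := circleAverage_add (hF'.add hG') hH'
      rw [circleAverage_add hF' hG'] at this
      simpa only [circleAverage_smul, smul_eq_mul] using! this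
    intro x hx
    refine (((hF.const_mul (v 0)).add (hG.const_mul (v 1))).add (hH.const_mul (v 2))).eq_zero
      hp hp0 hk ?_ ?_ hx
    · rw [hlin hF.circleIntegrable hG.circleIntegrable hH.circleIntegrable]
      linear_combination e0
    · have : (fun z => z * (v 0 * F z + v 1 * G z + v 2 * H z)) =
          fun z => v 0 * (z * F z) + v 1 * (z * G z) + v 2 * (z * H z) := by
        funext z; ring
      rw [this, hlin (hmulInt hF) (hmulInt hG) (hmulInt hH)]
      linear_combination e1

/-- Two-point uniqueness: `G` vanishes at `a`, `H` at `b`, and `F` at both. -/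
theorem IsDegreeTwo.eq_zero_of_two_zeros (hp : ‖p‖ < 1) (hp0 : p ≠ 0) (hk : k ≠ 0)
    (hF : IsDegreeTwo p k F) (hG : IsDegreeTwo p k G) (hH : IsDegreeTwo p k H) {a b : ℂ}
    (ha : a ≠ 0) (hb : b ≠ 0) (hGa : G a = 0) (hHb : H b = 0) (hHa : H a ≠ 0) (hGb : G b ≠ 0)
    (hFa : F a = 0) (hFb : F b = 0) {x : ℂ} (hx : x ≠ 0) : F x = 0 := by
  obtain ⟨u, v, w, hne, h⟩ := hF.exists_linear_relation hp hp0 hk hG hH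
  have h1 := h a ha
  have h2 := h b hb
  simp only [hFa, hGa, hFb, hHb, mul_zero, zero_add, add_zero, mul_eq_zero] at h1 h2
  have hw := h1.resolve_right hHa
  have hv := h2.resolve_right hGb
  have hu : u ≠ 0 := by simpa [hv, hw] using hne
  have h3 := h x hx
  simpa [hv, hw, hu] using h3

end DegreeTwo

/-! ### Theta function addition formulas. -/

section ThetaIdentities

variable {p : ℂ}

/-- The function `x ↦ θ(a x) θ(a c / x)`. -/
noncomputable def thetaPair (p c a x : ℂ) : ℂ := qTheta p (a * x) * qTheta p (a * c / x)

theorem isDegreeTwo_thetaPair (hp : ‖p‖ < 1) (hp0 : p ≠ 0) {c a : ℂ} (hc : c ≠ 0) (ha : a ≠ 0) :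
    IsDegreeTwo p (c / p) (thetaPair p c a) := by
  refine ⟨fun x hx => ?_, fun x hx => ?_⟩
  · refine DifferentiableAt.mul ?_ ?_
    · exact (differentiableAt_qTheta hp (mul_ne_zero ha hx)).comp x (f := fun x => a * x)
        (by fun_prop)
    · exact (differentiableAt_qTheta hp (div_ne_zero (mul_ne_zero ha hc) hx)).comp x
        (f := fun x => a * c / x) (by fun_prop (disch := assumption))
  · unfold thetaPair
    have h1 := qTheta_mul hp hp0 (mul_ne_zero ha hx)
    have h2 := qTheta_mul hp hp0 (div_ne_zero (mul_ne_zero ha hc) (mul_ne_zero hp0 hx))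
    rw [show p * (a * c / (p * x)) = a * c / x by field_simp] at h2
    rw [show a * (p * x) = p * (a * x) by ring, h1, h2]
    generalize qTheta p (a * c / (p * x)) = A
    generalize qTheta p (a * x) = B
    field_simp

theorem thetaPair_inv (hp : ‖p‖ < 1) {c a : ℂ} (ha : a ≠ 0) : thetaPair p c a a⁻¹ = 0 := by
  rw [thetaPair, mul_inv_cancel₀ ha, qTheta_one hp, zero_mul]

/-- The Weierstrass addition formula for theta functions. -/
theorem qTheta_weierstrass (hp : ‖p‖ < 1) (hp0 : p ≠ 0) {a b x y z : ℂ} (hz : z ≠ 0)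
    (hprod : a * b * x * y = p) (hz2 : qTheta p (z ^ 2) ≠ 0) (hab : qTheta p (a * b) ≠ 0) :
    qTheta p (z ^ 2) * qTheta p (a * b) * qTheta p (a * x) * qTheta p (a * y) =
      qTheta p (a * z) * qTheta p (b * z) * qTheta p (x * z) * qTheta p (y * z) -
      z ^ 2 * (qTheta p (a / z) * qTheta p (b / z) * qTheta p (x / z) * qTheta p (y / z)) := by
  have hne : a * b * x * y ≠ 0 := hprod ▸ hp0
  have hy : y ≠ 0 := right_ne_zero_of_mul hne
  have hx : x ≠ 0 := right_ne_zero_of_mul (left_ne_zero_of_mul hne)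
  have hb : b ≠ 0 := right_ne_zero_of_mul (left_ne_zero_of_mul (left_ne_zero_of_mul hne))
  have ha : a ≠ 0 := left_ne_zero_of_mul (left_ne_zero_of_mul (left_ne_zero_of_mul hne))
  obtain ⟨c, hc⟩ : ∃ c, c = p / (a * b) := ⟨_, rfl⟩
  have hc0 : c ≠ 0 := hc ▸ div_ne_zero hp0 (mul_ne_zero ha hb)
  have hyc : y = c / x := by
    rw [hc, ← hprod]; field_simp
  have hV := fun {e : ℂ} (he : e ≠ 0) => isDegreeTwo_thetaPair hp hp0 (c := c) hc0 he
  have hzi := inv_ne_zero hz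
  -- With ab fixed and y = c/x, each term is a `thetaPair` in x, so the difference of the two sides
  -- has degree two. It suffices to check it at x = 1/z and x = z, where one of the last two pairs
  -- vanishes.
  have hF := (((hV ha).const_mul (qTheta p (z ^ 2) * qTheta p (a * b))).add
    ((hV hz).const_mul (-(qTheta p (a * z) * qTheta p (b * z))))).add
    ((hV hzi).const_mul (z ^ 2 * (qTheta p (a / z) * qTheta p (b / z))))
  have hθc : qTheta p c = qTheta p (a * b) := by rw [hc, qTheta_div hp0]
  have hz2i : qTheta p (z⁻¹ * z⁻¹) = -(z ^ 2)⁻¹ * qTheta p (z ^ 2) := by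
    rw [← qTheta_inv hp hp0 (pow_ne_zero 2 hz)]
    congr 1; field_simp
  have e1 : qTheta p (z⁻¹ * c / z⁻¹) = qTheta p (a * b) := by
    rw [← hθc]; congr 1; field_simp
  have e2 : qTheta p (z * c / z) = qTheta p (a * b) := by
    rw [← hθc]; congr 1; field_simp
  have e3 : qTheta p (a * c / z⁻¹) = qTheta p (b / z) := by
    rw [← qTheta_div hp0, hc]; congr 1; field_simp
  have e4 : qTheta p (a * c / z) = qTheta p (b * z) := by
    rw [← qTheta_div hp0, hc]; congr 1; field_simp
  have key := hF.eq_zero_of_two_zeros hp hp0 (div_ne_zero hc0 hp0) (hV hz) (hV hzi) hzi hz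
    (thetaPair_inv hp hz) (by simpa using thetaPair_inv (c := c) hp hzi)
    (by
      rw [thetaPair, hz2i, e1]
      exact mul_ne_zero (mul_ne_zero (neg_ne_zero.2 (inv_ne_zero (pow_ne_zero 2 hz))) hz2) hab)
    (by
      rw [thetaPair, e2, ← pow_two]
      exact mul_ne_zero hz2 hab)
    (by
      simp only [thetaPair_inv hp hz]
      simp only [thetaPair, hz2i, e1, e3]
      rw [← div_eq_mul_inv]
      have e5 : z ^ 2 * (z ^ 2)⁻¹ = 1 := mul_inv_cancel₀ (pow_ne_zero 2 hz)
      linear_combination -(qTheta p (z ^ 2) * qTheta p (a * b) * qTheta p (a / z) *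
        qTheta p (b / z)) * e5)
    (by
      have : thetaPair p c z⁻¹ z = 0 := by simpa using thetaPair_inv (c := c) hp hzi
      simp only [this]
      simp only [thetaPair, e2, e4, ← pow_two]
      ring) hx
  simp only [thetaPair] at key
  rw [hyc, show a * (c / x) = a * c / x by ring, show c / x * z = z * c / x by ring,
    show c / x / z = z⁻¹ * c / x by ring, show x / z = z⁻¹ * x by ring, show x * z = z * x by ring]
  linear_combination key

/-- The combination of theta functions whose vanishing is `qTheta_six_term`, as a function of one
of the parameters. -/
noncomputable def sixTerm (p z a u b d c x : ℂ) : ℂ :=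
  z * qTheta p (z ^ 2) *
      (qTheta p (u * z) * qTheta p (u / z) * qTheta p (a * b) * qTheta p (a * d) *
          thetaPair p c a x -
        qTheta p (a * z) * qTheta p (a / z) * qTheta p (u * b) * qTheta p (u * d) *
          thetaPair p c u x) +
    u * qTheta p (a / u) *
      (qTheta p (a * z) * qTheta p (u * z) * qTheta p (b * z) * qTheta p (d * z) *
          thetaPair p c z x -
        z ^ 4 * (qTheta p (a / z) * qTheta p (u / z) * qTheta p (b / z) * qTheta p (d / z) *
          thetaPair p c z⁻¹ x))

theorem sixTerm_swap (hp : ‖p‖ < 1) (hp0 : p ≠ 0) {z a u b d c x : ℂ} (ha : a ≠ 0) (hu : u ≠ 0) :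
    sixTerm p z u a b d c x = -sixTerm p z a u b d c x := by
  have h := qTheta_inv hp hp0 (div_ne_zero ha hu)
  rw [inv_div] at h
  unfold sixTerm
  rw [h]
  field_simp
  ring

/-- At x = 1/u the pair belonging to u vanishes, and what remains is a multiple of
`qTheta_weierstrass` for the parameters a, b, d, cu. The antisymmetry in `sixTerm_swap` then gives
the zero at x = 1/a. -/
theorem sixTerm_eq_zero_at (hp : ‖p‖ < 1) (hp0 : p ≠ 0) {z a u b d c : ℂ} (hz : z ≠ 0)
    (hu : u ≠ 0) (hprod : a * b * d * (c * u) = p) (hz2 : qTheta p (z ^ 2) ≠ 0)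
    (hab : qTheta p (a * b) ≠ 0) : sixTerm p z a u b d c u⁻¹ = 0 := by
  have W := qTheta_weierstrass hp hp0 hz hprod hz2 hab
  have e1 : qTheta p (z * u⁻¹) = -(u / z)⁻¹ * qTheta p (u / z) := by
    rw [← qTheta_inv hp hp0 (div_ne_zero hu hz)]
    congr 1; field_simp
  have e2 : qTheta p (z⁻¹ * u⁻¹) = -(u * z)⁻¹ * qTheta p (u * z) := by
    rw [← qTheta_inv hp hp0 (mul_ne_zero hu hz)]
    congr 1; field_simp
  rw [sixTerm, thetaPair_inv hp hu]
  simp only [thetaPair, e1, e2]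
  rw [show a * c / u⁻¹ = a * (c * u) by field_simp, show z * c / u⁻¹ = c * u * z by field_simp,
    show z⁻¹ * c / u⁻¹ = c * u / z by field_simp, ← div_eq_mul_inv]
  have e3 : u * (u / z)⁻¹ = z := by field_simp
  have e4 : u * z ^ 4 * (u * z)⁻¹ = z ^ 3 := by field_simp
  linear_combination z * qTheta p (a / u) * qTheta p (u * z) * qTheta p (u / z) * W -
    qTheta p (a / u) * qTheta p (a * z) * qTheta p (u * z) * qTheta p (b * z) * qTheta p (d * z) *
      qTheta p (u / z) * qTheta p (c * u * z) * e3 +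
    qTheta p (a / u) * qTheta p (a / z) * qTheta p (u / z) * qTheta p (b / z) * qTheta p (d / z) *
      qTheta p (u * z) * qTheta p (c * u / z) * e4

theorem isDegreeTwo_sixTerm (hp : ‖p‖ < 1) (hp0 : p ≠ 0) {z a u b d c : ℂ} (hz : z ≠ 0)
    (ha : a ≠ 0) (hu : u ≠ 0) (hc : c ≠ 0) : IsDegreeTwo p (c / p) (sixTerm p z a u b d c) := by
  have hV := fun {e : ℂ} (he : e ≠ 0) => isDegreeTwo_thetaPair hp hp0 (c := c) hc he
  unfold sixTerm
  have h := ((((hV ha).const_mul (qTheta p (u * z) * qTheta p (u / z) * qTheta p (a * b) *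
    qTheta p (a * d))).add ((hV hu).const_mul (-(qTheta p (a * z) * qTheta p (a / z) *
    qTheta p (u * b) * qTheta p (u * d))))).const_mul (z * qTheta p (z ^ 2))).add
    ((((hV hz).const_mul (qTheta p (a * z) * qTheta p (u * z) * qTheta p (b * z) *
    qTheta p (d * z))).add ((hV (inv_ne_zero hz)).const_mul (-(z ^ 4 * (qTheta p (a / z) *
    qTheta p (u / z) * qTheta p (b / z) * qTheta p (d / z)))))).const_mul (u * qTheta p (a / u)))
  convert h using 1
  funext x
  ring

/-- The theta function identity behind the `q`-difference equation of the integrand. -/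
theorem qTheta_six_term (hp : ‖p‖ < 1) (hp0 : p ≠ 0) {z a b d x y u : ℂ} (hz : z ≠ 0)
    (hprod : a * b * d * x * y * u = p) (hz2 : qTheta p (z ^ 2) ≠ 0)
    (hab : qTheta p (a * b) ≠ 0) (hub : qTheta p (u * b) ≠ 0) (hbd : qTheta p (b * d) ≠ 0)
    (hau : a = u ∨ qTheta p (a / u) ≠ 0) :
    z * qTheta p (z ^ 2) *
      (qTheta p (u * z) * qTheta p (u / z) *
          (qTheta p (a * b) * qTheta p (a * d) * qTheta p (a * x) * qTheta p (a * y)) -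
        qTheta p (a * z) * qTheta p (a / z) *
          (qTheta p (u * b) * qTheta p (u * d) * qTheta p (u * x) * qTheta p (u * y))) +
    u * qTheta p (a / u) *
      (qTheta p (a * z) * qTheta p (b * z) * qTheta p (d * z) * qTheta p (x * z) *
          qTheta p (y * z) * qTheta p (u * z) -
        z ^ 4 * (qTheta p (a / z) * qTheta p (b / z) * qTheta p (d / z) * qTheta p (x / z) *
          qTheta p (y / z) * qTheta p (u / z))) = 0 := by
  have hne : a * b * d * x * y * u ≠ 0 := hprod ▸ hp0
  simp only [mul_ne_zero_iff] at hne
  obtain ⟨⟨⟨⟨⟨ha, hb⟩, hd⟩, hx⟩, hy⟩, hu⟩ := hne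
  rcases hau with rfl | hau
  · rw [div_self ha, qTheta_one hp]
    ring
  obtain ⟨c, hc⟩ : ∃ c, c = x * y := ⟨_, rfl⟩
  have hc0 : c ≠ 0 := hc ▸ mul_ne_zero hx hy
  have hua : qTheta p (u / a) ≠ 0 := by
    rw [← inv_div, qTheta_inv hp hp0 (div_ne_zero ha hu)]
    exact mul_ne_zero (neg_ne_zero.2 (inv_ne_zero (div_ne_zero ha hu))) hau
  -- Here acu = p/(bd), so the reflection x ↦ p/x reduces this to θ(bd) ≠ 0.
  have hacu : qTheta p (a * c * u) ≠ 0 := by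
    rw [← qTheta_div hp0]
    convert hbd using 2
    rw [← hprod, hc]
    field_simp
  have hV := fun {e : ℂ} (he : e ≠ 0) => isDegreeTwo_thetaPair hp hp0 (c := c) hc0 he
  -- The pairs of u and of a vanish at 1/u and 1/a respectively, and each is nonzero at the other
  -- point.
  have key := (isDegreeTwo_sixTerm hp hp0 (b := b) (d := d) hz ha hu hc0).eq_zero_of_two_zeros
    hp hp0 (div_ne_zero hc0 hp0) (hV hu) (hV ha) (inv_ne_zero hu) (inv_ne_zero ha)
    (thetaPair_inv hp hu) (thetaPair_inv hp ha)
    (by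
      rw [thetaPair, ← div_eq_mul_inv, show a * c / u⁻¹ = a * c * u by field_simp]
      exact mul_ne_zero hau hacu)
    (by
      rw [thetaPair, ← div_eq_mul_inv, show u * c / a⁻¹ = a * c * u by field_simp]
      exact mul_ne_zero hua hacu)
    (sixTerm_eq_zero_at hp hp0 hz hu (by rw [← hprod, hc]; ring) hz2 hab)
    (by
      rw [← neg_eq_zero, ← sixTerm_swap hp hp0 ha hu]
      exact sixTerm_eq_zero_at hp hp0 hz ha (by rw [← hprod, hc]; ring) hz2 hub) hx
  have hyc : ∀ e, e * c / x = e * y := fun e => by rw [hc]; field_simp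
  simp only [sixTerm, thetaPair, hyc] at key
  simp only [inv_mul_eq_div, mul_comm z] at key
  linear_combination key

end ThetaIdentities

/-! ### The q-difference equation of the integral. -/

section Integrand

variable {p q : ℂ}

theorem norm_mul_lt_one {x y : ℂ} (hx : ‖x‖ < 1) (hy : ‖y‖ < 1) : ‖x * y‖ < 1 := by
  rw [norm_mul]
  exact mul_lt_one_of_nonneg_of_lt_one_left (norm_nonneg _) hx hy.le

theorem norm_mul_lt_one_of_le {x y : ℂ} (hx : ‖x‖ < 1) (hy : ‖y‖ ≤ 1) : ‖x * y‖ < 1 := by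
  rw [norm_mul]
  exact mul_lt_one_of_nonneg_of_lt_one_left (norm_nonneg _) hx hy

theorem ne_zero_of_norm_eq_one {z : ℂ} (hz : ‖z‖ = 1) : z ≠ 0 := by
  rintro rfl
  simp at hz

theorem forall_vecSix {P : ℂ → Prop} {a b d x y u : ℂ} (ha : P a) (hb : P b) (hd : P d)
    (hx : P x) (hy : P y) (hu : P u) : ∀ k : Fin 6, P (![a, b, d, x, y, u] k) := by
  intro k
  fin_cases k <;> assumption

theorem ne_zero_of_prod_eq {ι : Type*} [Fintype ι] {t : ι → ℂ} {c : ℂ} (hc : c ≠ 0)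
    (h : ∏ k, t k = c) (k : ι) : t k ≠ 0 := by
  classical
  exact Finset.prod_ne_zero_iff.1 (h ▸ hc) k (Finset.mem_univ k)

/-- The product `Γ(a z) Γ(a / z)`. -/
noncomputable def gammaPair (p q a z : ℂ) : ℂ := ellGamma (a * z) p q * ellGamma (a * z⁻¹) p q

/-- The theta function form of `1 / (Γ(z ^ 2) Γ(z ^ (-2)))`. -/
noncomputable def thetaWeight (p q z : ℂ) : ℂ := qTheta p (z ^ 2) * qTheta q (z ^ 2)⁻¹

theorem ellBetaIntegrand_eq (hp : ‖p‖ < 1) (hq : ‖q‖ < 1) (t : Fin 6 → ℂ) {z : ℂ}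
    (hz : ‖z‖ = 1) :
    ellBetaIntegrand t p q z = (∏ k, gammaPair p q (t k) z) * thetaWeight p q z := by
  have hz2 : ‖z ^ 2‖ = 1 := by simp [hz]
  rw [ellBetaIntegrand, div_eq_mul_inv, show z ^ (-2 : ℤ) = (z ^ 2)⁻¹ by
    rw [zpow_neg]; rfl, inv_ellGamma_mul_ellGamma_inv hp hq hz2]
  rfl

theorem differentiableAt_thetaWeight (hp : ‖p‖ < 1) (hq : ‖q‖ < 1) {z : ℂ} (hz : z ≠ 0) :
    DifferentiableAt ℂ (thetaWeight p q) z := by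
  have hz2 := pow_ne_zero 2 hz
  refine DifferentiableAt.mul ?_ ?_
  · exact (differentiableAt_qTheta hp hz2).comp z (f := fun z => z ^ 2) (by fun_prop)
  · exact (differentiableAt_qTheta hq (inv_ne_zero hz2)).comp z (f := fun z => (z ^ 2)⁻¹)
      (by fun_prop (disch := assumption))

theorem differentiableAt_gammaPair (hp : ‖p‖ < 1) (hq : ‖q‖ < 1) {a z : ℂ} (ha : a ≠ 0)
    (hz : z ≠ 0) (h1 : ‖a * z‖ < 1) (h2 : ‖a * z⁻¹‖ < 1) :
    DifferentiableAt ℂ (gammaPair p q a) z := by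
  refine DifferentiableAt.mul ?_ ?_
  · exact (differentiableAt_ellGamma hp hq (mul_ne_zero ha hz) h1).comp z (f := fun z => a * z)
      (by fun_prop)
  · exact (differentiableAt_ellGamma hp hq (mul_ne_zero ha (inv_ne_zero hz)) h2).comp z
      (f := fun z => a * z⁻¹) (by fun_prop (disch := assumption))

theorem continuousOn_ellBetaIntegrand (hp : ‖p‖ < 1) (hq : ‖q‖ < 1) {t : Fin 6 → ℂ}
    (ht0 : ∀ k, t k ≠ 0) (ht : ∀ k, ‖t k‖ < 1) :
    ContinuousOn (ellBetaIntegrand t p q) (Metric.sphere 0 1) := by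
  have h : ContinuousOn (fun z => (∏ k, gammaPair p q (t k) z) * thetaWeight p q z)
      (Metric.sphere 0 1) := by
    intro z hz
    have hz1 : ‖z‖ = 1 := mem_sphere_zero_iff_norm.1 hz
    have hz0 := ne_zero_of_norm_eq_one hz1
    refine ContinuousAt.continuousWithinAt (ContinuousAt.mul ?_
      (differentiableAt_thetaWeight hp hq hz0).continuousAt)
    exact tendsto_finsetProd _ fun k _ =>
      (differentiableAt_gammaPair hp hq (ht0 k) hz0 (by simpa [hz1] using ht k)
        (by simpa [hz1] using ht k)).continuousAt
  exact h.congr fun z hz => ellBetaIntegrand_eq hp hq t (mem_sphere_zero_iff_norm.1 hz)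

theorem circleIntegrable_ellBetaIntegrand (hp : ‖p‖ < 1) (hq : ‖q‖ < 1) {t : Fin 6 → ℂ}
    (ht0 : ∀ k, t k ≠ 0) (ht : ∀ k, ‖t k‖ < 1) :
    CircleIntegrable (ellBetaIntegrand t p q) 0 1 :=
  (continuousOn_ellBetaIntegrand hp hq ht0 ht).circleIntegrable zero_le_one

theorem circleIntegrable_ellBetaIntegrand_div (hp : ‖p‖ < 1) (hq : ‖q‖ < 1) {t : Fin 6 → ℂ}
    (ht0 : ∀ k, t k ≠ 0) (ht : ∀ k, ‖t k‖ < 1) :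
    CircleIntegrable (fun z => ellBetaIntegrand t p q z / z) 0 1 :=
  ((continuousOn_ellBetaIntegrand hp hq ht0 ht).div continuousOn_id fun _ hz =>
    ne_zero_of_norm_eq_one (mem_sphere_zero_iff_norm.1 hz)).circleIntegrable zero_le_one

/-- The function whose antisymmetrization under `z ↦ 1 / z` is the difference of two integrands
with shifted parameters. -/
noncomputable def shiftKernel (p q : ℂ) (t : Fin 6 → ℂ) (z : ℂ) : ℂ :=
  (∏ k, ellGamma (q * (t k * z)) p q * ellGamma (t k * z⁻¹) p q) * qTheta q (z ^ 2)⁻¹ * z⁻¹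

/-- Under z ↦ z/q the factors Γ(q t z) and Γ(t/z) become Γ(t z) and Γ(q t/z), as they do under z ↦
1/z. The remaining factors θ(z⁻²; q) z⁻¹ supply the sign. -/
theorem shiftKernel_inv_mul (hq : ‖q‖ < 1) (hq0 : q ≠ 0) (t : Fin 6 → ℂ) {z : ℂ} (hz : z ≠ 0) :
    shiftKernel p q t (q⁻¹ * z) = -shiftKernel p q t z⁻¹ := by
  have hz2 := pow_ne_zero 2 hz
  have h1 : qTheta q ((q⁻¹ * z) ^ 2)⁻¹ = -q⁻¹ * z ^ 2 * qTheta q (z ^ 2) := by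
    rw [show ((q⁻¹ * z) ^ 2)⁻¹ = q * (q * (z ^ 2)⁻¹) by field_simp,
      qTheta_mul hq hq0 (mul_ne_zero hq0 (inv_ne_zero hz2)), qTheta_mul hq hq0 (inv_ne_zero hz2),
      qTheta_inv hq hq0 hz2]
    field_simp
  have h2 : (∏ k, ellGamma (q * (t k * (q⁻¹ * z))) p q * ellGamma (t k * (q⁻¹ * z)⁻¹) p q) =
      ∏ k, ellGamma (q * (t k * z⁻¹)) p q * ellGamma (t k * z⁻¹⁻¹) p q := by
    refine Finset.prod_congr rfl fun k _ => ?_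
    rw [mul_comm (ellGamma _ _ _), inv_inv]
    congr 2 <;> field_simp
  rw [shiftKernel, shiftKernel, h1, h2, show (z⁻¹ ^ 2)⁻¹ = z ^ 2 by field_simp]
  generalize (∏ k, ellGamma (q * (t k * z⁻¹)) p q * ellGamma (t k * z⁻¹⁻¹) p q) = P
  field_simp

/-- On this annulus both |q t z| and |t/z| stay below 1; writing Γ(q t z) instead of θ(t z) Γ(t z)
avoids the poles of Γ(t z) outside the unit circle. -/
theorem differentiableAt_shiftKernel (hp : ‖p‖ < 1) (hq : ‖q‖ < 1) (hq0 : q ≠ 0) {t : Fin 6 → ℂ}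
    (ht0 : ∀ k, t k ≠ 0) (ht : ∀ k, ‖t k‖ < 1) {z : ℂ} (h1 : 1 ≤ ‖z‖) (h2 : ‖z‖ ≤ ‖q⁻¹‖) :
    DifferentiableAt ℂ (shiftKernel p q t) z := by
  have hz : z ≠ 0 := norm_pos_iff.1 (one_pos.trans_le h1)
  have hz2 := pow_ne_zero 2 hz
  have hqz : ‖q * z‖ ≤ 1 := by
    rw [norm_mul]
    calc ‖q‖ * ‖z‖ ≤ ‖q‖ * ‖q⁻¹‖ := by gcongr
      _ = 1 := by rw [← norm_mul, mul_inv_cancel₀ hq0, norm_one]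
  have hzi : ‖z⁻¹‖ ≤ 1 := by
    rw [norm_inv]; exact inv_le_one_of_one_le₀ h1
  refine DifferentiableAt.mul (DifferentiableAt.mul ?_ ?_) (differentiableAt_inv hz)
  · refine DifferentiableAt.fun_finsetProd fun k _ => DifferentiableAt.mul ?_ ?_
    · have h3 : ‖q * (t k * z)‖ < 1 := by
        rw [mul_left_comm]
        exact norm_mul_lt_one_of_le (ht k) hqz
      exact (differentiableAt_ellGamma hp hq (mul_ne_zero hq0 (mul_ne_zero (ht0 k) hz)) h3).comp z
        (f := fun z => q * (t k * z)) (by fun_prop)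
    · exact (differentiableAt_ellGamma hp hq (mul_ne_zero (ht0 k) (inv_ne_zero hz))
        (norm_mul_lt_one_of_le (ht k) hzi)).comp z
        (f := fun z => t k * z⁻¹) (by fun_prop (disch := assumption))
  · exact (differentiableAt_qTheta hq (inv_ne_zero hz2)).comp z (f := fun z => (z ^ 2)⁻¹)
      (by fun_prop (disch := assumption))

theorem one_le_norm_inv (hq : ‖q‖ < 1) (hq0 : q ≠ 0) : 1 ≤ ‖q⁻¹‖ := by
  rw [norm_inv]
  exact (one_le_inv₀ (norm_pos_iff.2 hq0)).2 hq.le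

/-- The mean over |z| = 1 equals that over |z| = 1/|q|, hence that of K(z/q) = -K(1/z) over |z| = 1,
which is minus the original mean. -/
theorem circleAverage_shiftKernel (hp : ‖p‖ < 1) (hq : ‖q‖ < 1) (hq0 : q ≠ 0) {t : Fin 6 → ℂ}
    (ht0 : ∀ k, t k ≠ 0) (ht : ∀ k, ‖t k‖ < 1) :
    circleAverage (shiftKernel p q t) 0 1 = 0 := by
  have h1 : circleAverage (shiftKernel p q t) 0 ‖q⁻¹‖ = circleAverage (shiftKernel p q t) 0 1 :=
    circleAverage_eq_of_differentiableAt_annulus one_pos (one_le_norm_inv hq hq0) fun z hz hz' =>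
      differentiableAt_shiftKernel hp hq hq0 ht0 ht hz hz'
  have h2 := circleAverage_comp_mul (f := shiftKernel p q t) q⁻¹ 1
  have h3 : circleAverage (fun z => shiftKernel p q t (q⁻¹ * z)) 0 1 =
      circleAverage ((-1 : ℂ) • fun z => shiftKernel p q t z⁻¹) 0 1 :=
    circleAverage_congr_sphere fun z hz => by
      simpa using shiftKernel_inv_mul hq hq0 t (ne_zero_of_norm_eq_one (by simpa using hz))
  rw [mul_one, h3, h1, circleAverage_smul, circleAverage_zero_one_congr_inv, neg_one_smul] at h2
  exact CharZero.neg_eq_self_iff.1 h2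

theorem circleIntegrable_shiftKernel (hp : ‖p‖ < 1) (hq : ‖q‖ < 1) (hq0 : q ≠ 0) {t : Fin 6 → ℂ}
    (ht0 : ∀ k, t k ≠ 0) (ht : ∀ k, ‖t k‖ < 1) :
    CircleIntegrable (shiftKernel p q t) 0 1 ∧
      CircleIntegrable (fun z => shiftKernel p q t z⁻¹) 0 1 := by
  have hc : ∀ z, ‖z‖ = 1 → ContinuousAt (shiftKernel p q t) z := fun z hz =>
    (differentiableAt_shiftKernel hp hq hq0 ht0 ht hz.ge
      (hz.le.trans (one_le_norm_inv hq hq0))).continuousAt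
  refine ⟨ContinuousOn.circleIntegrable zero_le_one fun z hz =>
    (hc z (by simpa using hz)).continuousWithinAt,
    ContinuousOn.circleIntegrable zero_le_one fun z hz => ?_⟩
  have hz1 : ‖z‖ = 1 := by simpa using hz
  exact ((hc z⁻¹ (by simp [hz1])).comp (f := fun z : ℂ => z⁻¹)
    (continuousAt_inv₀ (ne_zero_of_norm_eq_one hz1))).continuousWithinAt

theorem gammaPair_mul_left (hp : ‖p‖ < 1) (hq : ‖q‖ < 1) (hp0 : p ≠ 0) (hq0 : q ≠ 0) {a z : ℂ}
    (ha0 : a ≠ 0) (ha : ‖a‖ < 1) (hz : ‖z‖ = 1) :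
    gammaPair p q (q * a) z = qTheta p (a * z) * qTheta p (a / z) * gammaPair p q a z := by
  have hz0 := ne_zero_of_norm_eq_one hz
  rw [gammaPair, gammaPair, mul_assoc, mul_assoc,
    ellGamma_mul_left hp hq hp0 hq0 (mul_ne_zero ha0 hz0) (by simpa [hz] using ha),
    ellGamma_mul_left hp hq hp0 hq0 (mul_ne_zero ha0 (inv_ne_zero hz0)) (by simpa [hz] using ha),
    ← div_eq_mul_inv]
  ring

theorem shiftKernel_eq (hp : ‖p‖ < 1) (hq : ‖q‖ < 1) (hp0 : p ≠ 0) (hq0 : q ≠ 0) {t : Fin 6 → ℂ}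
    (ht0 : ∀ k, t k ≠ 0) (ht : ∀ k, ‖t k‖ < 1) {z : ℂ} (hz : ‖z‖ = 1) :
    shiftKernel p q t z = (∏ k, gammaPair p q (t k) z) * (∏ k, qTheta p (t k * z)) *
      qTheta q (z ^ 2)⁻¹ * z⁻¹ := by
  have hz0 := ne_zero_of_norm_eq_one hz
  rw [shiftKernel, ← Finset.prod_mul_distrib]
  congr 2
  refine Finset.prod_congr rfl fun k _ => ?_
  rw [ellGamma_mul_left hp hq hp0 hq0 (mul_ne_zero (ht0 k) hz0) (by simpa [hz] using ht k),
    gammaPair]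
  ring

theorem gammaPair_inv (a z : ℂ) : gammaPair p q a z⁻¹ = gammaPair p q a z := by
  rw [gammaPair, gammaPair, inv_inv, mul_comm]

theorem shiftKernel_add_inv (hp : ‖p‖ < 1) (hq : ‖q‖ < 1) (hp0 : p ≠ 0) (hq0 : q ≠ 0)
    {t : Fin 6 → ℂ} (ht0 : ∀ k, t k ≠ 0) (ht : ∀ k, ‖t k‖ < 1) {z : ℂ} (hz : ‖z‖ = 1) :
    shiftKernel p q t z + shiftKernel p q t z⁻¹ = (∏ k, gammaPair p q (t k) z) *
      qTheta q (z ^ 2)⁻¹ * z⁻¹ *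
        ((∏ k, qTheta p (t k * z)) - z ^ 4 * ∏ k, qTheta p (t k / z)) := by
  have hz0 := ne_zero_of_norm_eq_one hz
  have h1 := qTheta_inv hq hq0 (pow_ne_zero 2 hz0)
  rw [shiftKernel_eq hp hq hp0 hq0 ht0 ht hz,
    shiftKernel_eq hp hq hp0 hq0 ht0 ht (z := z⁻¹) (by simp [hz]), h1, inv_inv,
    show (z⁻¹ ^ 2)⁻¹ = z ^ 2 by field_simp]
  simp only [gammaPair_inv, ← div_eq_mul_inv]
  generalize (∏ k, qTheta p (t k / z)) = P
  generalize (∏ k, qTheta p (t k * z)) = Q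
  field_simp
  ring

/-- The hypotheses force |p| < |x| < 1, an annulus free of zeros of θ. -/
theorem qTheta_ne_zero_of_mul_eq (hp : ‖p‖ < 1) {x y : ℂ} (hp0 : p ≠ 0) (h : x * y = p)
    (hx : ‖x‖ < 1) (hy : ‖y‖ < 1) : qTheta p x ≠ 0 := by
  have hx0 : x ≠ 0 := left_ne_zero_of_mul (h ▸ hp0)
  refine qTheta_ne_zero hp ?_ (norm_mul_lt_one hp hx) ?_
  · rintro rfl
    simp at hx
  · rwa [← h, mul_div_cancel_left₀ _ hx0]

/-- Every term contains the same gamma factors and θ(z⁻²; q); dividing them out leaves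
`qTheta_six_term`. -/
theorem ellBetaIntegrand_shift_sub (hp : ‖p‖ < 1) (hq : ‖q‖ < 1) (hp0 : p ≠ 0) (hq0 : q ≠ 0)
    {a b d x y u : ℂ} (ha : ‖a‖ < 1) (hb : ‖b‖ < 1) (hd : ‖d‖ < 1) (hx : ‖x‖ < 1) (hy : ‖y‖ < 1)
    (hu : ‖u‖ < 1) (hprod : a * b * d * x * y * u = p) {z : ℂ} (hz : ‖z‖ = 1) :
    ellBetaIntegrand ![a, b, d, x, y, q * u] p q z *
        (qTheta p (a * b) * qTheta p (a * d) * qTheta p (a * x) * qTheta p (a * y)) -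
      ellBetaIntegrand ![q * a, b, d, x, y, u] p q z *
        (qTheta p (u * b) * qTheta p (u * d) * qTheta p (u * x) * qTheta p (u * y)) =
      -(u * qTheta p (a / u)) *
        (shiftKernel p q ![a, b, d, x, y, u] z + shiftKernel p q ![a, b, d, x, y, u] z⁻¹) := by
  have hne : a * b * d * x * y * u ≠ 0 := hprod ▸ hp0
  simp only [mul_ne_zero_iff] at hne
  obtain ⟨⟨⟨⟨⟨ha0, hb0⟩, hd0⟩, hx0⟩, hy0⟩, hu0⟩ := hne
  have hz0 := ne_zero_of_norm_eq_one hz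
  have hz21 : ‖z ^ 2‖ = 1 := by simp [hz]
  rw [shiftKernel_add_inv hp hq hp0 hq0 (forall_vecSix (P := fun w => w ≠ 0) ha0 hb0 hd0 hx0 hy0 hu0)
    (forall_vecSix (P := fun w => ‖w‖ < 1) ha hb hd hx hy hu) hz, ellBetaIntegrand_eq hp hq _ hz,
    ellBetaIntegrand_eq hp hq _ hz]
  simp only [Fin.prod_univ_six, Matrix.cons_val]
  rw [gammaPair_mul_left hp hq hp0 hq0 ha0 ha hz, gammaPair_mul_left hp hq hp0 hq0 hu0 hu hz,
    thetaWeight]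
  -- The six-term identity needs θ(z²; p) ≠ 0; at z = ±1 the common factor θ(z⁻²; q) kills both
  -- sides.
  by_cases hz2 : z ^ 2 = 1
  · rw [hz2, inv_one, qTheta_one hq]
    ring
  · have hθ : qTheta p (z ^ 2) ≠ 0 :=
      qTheta_ne_zero hp hz2 (by simpa [hz] using hp) (by simpa [hz] using hp)
    have N := fun {x y : ℂ} => norm_mul_lt_one (x := x) (y := y)
    have hab := qTheta_ne_zero_of_mul_eq (x := a * b) (y := d * x * y * u) hp hp0
      (by rw [← hprod]; ring) (N ha hb) (N (N (N hd hx) hy) hu)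
    have hub := qTheta_ne_zero_of_mul_eq (x := u * b) (y := d * x * y * a) hp hp0
      (by rw [← hprod]; ring) (N hu hb) (N (N (N hd hx) hy) ha)
    have hbd := qTheta_ne_zero_of_mul_eq (x := b * d) (y := u * x * y * a) hp hp0
      (by rw [← hprod]; ring) (N hb hd) (N (N (N hu hx) hy) ha)
    have hau : a = u ∨ qTheta p (a / u) ≠ 0 := by
      by_cases h : a = u
      · exact Or.inl h
      · refine Or.inr (qTheta_ne_zero hp (fun h' => h ((div_eq_one_iff_eq hu0).1 h')) ?_ ?_)
        · rw [show p * (a / u) = a * b * d * x * y * a by rw [← hprod]; field_simp]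
          exact N (N (N (N (N ha hb) hd) hx) hy) ha
        · rw [show p / (a / u) = u * b * d * x * y * u by rw [← hprod]; field_simp]
          exact N (N (N (N (N hu hb) hd) hx) hy) hu
    have key := qTheta_six_term hp hp0 hz0 hprod hθ hab hub hbd hau
    have hzz : z⁻¹ * z = 1 := inv_mul_cancel₀ hz0
    set G := gammaPair p q a z * gammaPair p q b z * gammaPair p q d z * gammaPair p q x z *
      gammaPair p q y z * gammaPair p q u z with hG
    linear_combination G * qTheta q (z ^ 2)⁻¹ * z⁻¹ * key - G * qTheta q (z ^ 2)⁻¹ *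
      qTheta p (z ^ 2) * (qTheta p (u * z) * qTheta p (u / z) *
          (qTheta p (a * b) * qTheta p (a * d) * qTheta p (a * x) * qTheta p (a * y)) -
        qTheta p (a * z) * qTheta p (a / z) *
          (qTheta p (u * b) * qTheta p (u * d) * qTheta p (u * x) * qTheta p (u * y))) * hzz

theorem circleAverage_ellBetaIntegrand_shift (hp : ‖p‖ < 1) (hq : ‖q‖ < 1) (hp0 : p ≠ 0)
    (hq0 : q ≠ 0) {a b d x y u : ℂ} (ha : ‖a‖ < 1) (hb : ‖b‖ < 1) (hd : ‖d‖ < 1) (hx : ‖x‖ < 1)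
    (hy : ‖y‖ < 1) (hu : ‖u‖ < 1) (hprod : a * b * d * x * y * u = p) :
    circleAverage (ellBetaIntegrand ![a, b, d, x, y, q * u] p q) 0 1 *
        (qTheta p (a * b) * qTheta p (a * d) * qTheta p (a * x) * qTheta p (a * y)) =
      circleAverage (ellBetaIntegrand ![q * a, b, d, x, y, u] p q) 0 1 *
        (qTheta p (u * b) * qTheta p (u * d) * qTheta p (u * x) * qTheta p (u * y)) := by
  have hne : a * b * d * x * y * u ≠ 0 := hprod ▸ hp0
  simp only [mul_ne_zero_iff] at hne
  obtain ⟨⟨⟨⟨⟨ha0, hb0⟩, hd0⟩, hx0⟩, hy0⟩, hu0⟩ := hne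
  have hqu := norm_mul_lt_one hq hu
  have hqa := norm_mul_lt_one hq ha
  have h0 : ∀ k, ![a, b, d, x, y, u] k ≠ 0 :=
    forall_vecSix (P := fun w => w ≠ 0) ha0 hb0 hd0 hx0 hy0 hu0
  have h1 : ∀ k, ‖![a, b, d, x, y, u] k‖ < 1 :=
    forall_vecSix (P := fun w => ‖w‖ < 1) ha hb hd hx hy hu
  have i1 := circleIntegrable_ellBetaIntegrand (t := ![a, b, d, x, y, q * u]) hp hq
    (forall_vecSix (P := fun w => w ≠ 0) ha0 hb0 hd0 hx0 hy0 (mul_ne_zero hq0 hu0))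
    (forall_vecSix (P := fun w => ‖w‖ < 1) ha hb hd hx hy hqu)
  have i2 := circleIntegrable_ellBetaIntegrand (t := ![q * a, b, d, x, y, u]) hp hq
    (forall_vecSix (P := fun w => w ≠ 0) (mul_ne_zero hq0 ha0) hb0 hd0 hx0 hy0 hu0)
    (forall_vecSix (P := fun w => ‖w‖ < 1) hqa hb hd hx hy hu)
  obtain ⟨i3, i4⟩ := circleIntegrable_shiftKernel hp hq hq0 h0 h1
  set A := qTheta p (a * b) * qTheta p (a * d) * qTheta p (a * x) * qTheta p (a * y)
  set B := qTheta p (u * b) * qTheta p (u * d) * qTheta p (u * x) * qTheta p (u * y)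
  have e := circleAverage_congr_sphere (c := 0) (R := 1)
    (f₁ := A • ellBetaIntegrand ![a, b, d, x, y, q * u] p q -
      B • ellBetaIntegrand ![q * a, b, d, x, y, u] p q)
    (f₂ := (-(u * qTheta p (a / u))) • (shiftKernel p q ![a, b, d, x, y, u] +
      fun z => shiftKernel p q ![a, b, d, x, y, u] z⁻¹)) (fun z hz => by
      have := ellBetaIntegrand_shift_sub hp hq hp0 hq0 ha hb hd hx hy hu hprod (z := z)
        (by simpa using hz)
      simp only [Pi.sub_apply, Pi.smul_apply, Pi.add_apply, smul_eq_mul]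
      linear_combination this)
  rw [circleAverage_sub (i1.const_smul (a := A)) (i2.const_smul (a := B)), circleAverage_smul,
    circleAverage_smul, circleAverage_smul, circleAverage_add i3 i4,
    circleAverage_zero_one_congr_inv, circleAverage_shiftKernel hp hq hq0 h0 h1] at e
  simp only [smul_eq_mul, add_zero, mul_zero] at e
  linear_combination e

end Integrand

/-! ### Holomorphic dependence of circle means on a parameter. -/

section ParametricAverage

theorem differentiableOn_circleAverage {V : Set ℂ} (hV : IsOpen V) {F : ℂ → ℂ → ℂ}
    (hc : ContinuousOn (Function.uncurry F) (V ×ˢ Metric.sphere 0 1))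
    (hd : ∀ z ∈ Metric.sphere (0 : ℂ) 1, DifferentiableOn ℂ (fun s => F s z) V) :
    DifferentiableOn ℂ (fun s => circleAverage (F s) 0 1) V := by
  intro s₀ hs₀
  obtain ⟨r, hr, hball⟩ := Metric.isOpen_iff.1 hV s₀ hs₀
  obtain ⟨ε, hε, hεr⟩ : ∃ ε > 0, 2 * ε < r := ⟨r / 3, by positivity, by linarith⟩
  have hcl : Metric.closedBall s₀ (2 * ε) ⊆ V :=
    (Metric.closedBall_subset_ball hεr).trans hball
  have hmem : ∀ θ : ℝ, circleMap 0 1 θ ∈ Metric.sphere (0 : ℂ) 1 := fun θ =>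
    circleMap_mem_sphere 0 zero_le_one θ
  have hcont : ∀ s ∈ V, Continuous fun θ : ℝ => F s (circleMap 0 1 θ) := fun s hs =>
    hc.comp_continuous (f := fun θ : ℝ => (s, circleMap 0 1 θ))
      (continuous_const.prodMk (continuous_circleMap 0 1)) fun θ => ⟨hs, hmem θ⟩
  obtain ⟨M, hM⟩ := (((isCompact_closedBall s₀ (2 * ε)).prod
    (isCompact_sphere (0 : ℂ) 1)).image_of_continuousOn
    (hc.mono (Set.prod_mono_left hcl))).isBounded.exists_norm_le
  have hM' : ∀ s ∈ Metric.closedBall s₀ (2 * ε), ∀ θ : ℝ, ‖F s (circleMap 0 1 θ)‖ ≤ M :=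
    fun s hs θ => hM _ ⟨(s, circleMap 0 1 θ), ⟨hs, hmem θ⟩, rfl⟩
  have hda : ∀ θ : ℝ, ∀ s ∈ V, HasDerivAt (fun s => F s (circleMap 0 1 θ))
      (deriv (fun s => F s (circleMap 0 1 θ)) s) s := fun θ s hs =>
    ((hd _ (hmem θ)).differentiableAt (hV.mem_nhds hs)).hasDerivAt
  -- The parameter derivative is a pointwise limit of difference quotients continuous in θ.
  have hmeas : MeasureTheory.AEStronglyMeasurable
      (fun θ : ℝ => deriv (fun s => F s (circleMap 0 1 θ)) s₀)
      (MeasureTheory.volume.restrict (Set.uIoc 0 (2 * π))) := by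
    obtain ⟨σ, hσ⟩ := exists_seq_tendsto (𝓝[≠] s₀)
    have hσV : ∀ᶠ n in atTop, σ n ∈ V :=
      hσ.eventually (eventually_nhdsWithin_of_eventually_nhds (hV.mem_nhds hs₀))
    obtain ⟨N, hN⟩ := eventually_atTop.1 hσV
    refine aestronglyMeasurable_of_tendsto_ae atTop
      (f := fun n θ => slope (fun s => F s (circleMap 0 1 θ)) s₀ (σ (n + N))) (fun n => ?_)
      (.of_forall fun θ => ?_)
    · have h1 := hcont _ (hN (n + N) (Nat.le_add_left _ _))
      have h2 := hcont _ hs₀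
      refine Continuous.aestronglyMeasurable ?_
      simp only [slope_def_field]
      exact (h1.sub h2).div_const _
    · exact (hasDerivAt_iff_tendsto_slope.1 (hda θ s₀ hs₀)).comp
        (hσ.comp (tendsto_add_atTop_nat N))
  have key := intervalIntegral.hasDerivAt_integral_of_dominated_loc_of_deriv_le
    (μ := MeasureTheory.volume) (a := 0) (b := 2 * π) (F := fun s θ => F s (circleMap 0 1 θ))
    (F' := fun s θ => deriv (fun s => F s (circleMap 0 1 θ)) s) (x₀ := s₀)
    (s := Metric.ball s₀ ε) (bound := fun _ => M / ε) (Metric.ball_mem_nhds s₀ hε)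
    (eventually_of_mem (hV.mem_nhds hs₀) fun s hs => (hcont s hs).aestronglyMeasurable)
    ((hcont s₀ hs₀).intervalIntegrable _ _) hmeas
    (.of_forall fun θ _ s hs => by
      -- Cauchy's estimate on a disc of radius ε about s gives the dominating constant M / ε; the
      -- bound M holds on the disc of radius 2ε about s₀.
      have hsub : Metric.closedBall s ε ⊆ Metric.closedBall s₀ (2 * ε) :=
        Metric.closedBall_subset_closedBall' (by linarith [Metric.mem_ball.1 hs])
      refine Complex.norm_deriv_le_of_forall_mem_sphere_norm_le hε ?_ fun w hw =>
        hM' w (hsub (Metric.sphere_subset_closedBall hw)) θ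
      refine DifferentiableOn.diffContOnCl ?_
      rw [closure_ball s hε.ne']
      exact (hd _ (hmem θ)).mono (hsub.trans hcl))
    (by simp)
    (.of_forall fun θ _ s hs => hda θ s (hcl (Metric.ball_subset_closedBall
      (Metric.ball_subset_ball (by linarith) hs))))
  exact (key.2.differentiableAt.const_smul _).differentiableWithinAt

end ParametricAverage

/-! ### The normalized integral: shift invariance and holomorphy. -/

section Ratio

variable {p q : ℂ}

/-- The right-hand side of the elliptic beta integral. -/
noncomputable def gammaPairProd (p q : ℂ) (t : Fin 6 → ℂ) : ℂ :=
  ∏ j : Fin 6, ∏ k ∈ Finset.Ioi j, ellGamma (t j * t k) p q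

/-- The quotient of the mean value of the integrand by the product of gamma functions. -/
noncomputable def betaRatio (p q : ℂ) (t : Fin 6 → ℂ) : ℂ :=
  circleAverage (ellBetaIntegrand t p q) 0 1 / gammaPairProd p q t

/-- The domain of parameters of the elliptic beta integral. -/
def betaDomain (p q : ℂ) : Set (Fin 6 → ℂ) := {t | (∀ k, ‖t k‖ < 1) ∧ ∏ k, t k = p * q}

/-- The quotient is the product of the other four parameters; one strict bound, from a third index
l, is enough. -/
theorem norm_div_mul_lt_one {t : Fin 6 → ℂ} {c : ℂ} (hc : c ≠ 0) (ht : ∀ k, ‖t k‖ < 1)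
    (hprod : ∏ k, t k = c) {j k : Fin 6} (hjk : j ≠ k) : ‖c / (t j * t k)‖ < 1 := by
  have h0 := ne_zero_of_prod_eq hc hprod
  obtain ⟨l, hlj, hlk⟩ : ∃ l, l ≠ j ∧ l ≠ k := by
    revert j k
    decide
  have e : c = t j * t k * (t l * ∏ i ∈ ((Finset.univ.erase j).erase k).erase l, t i) := by
    rw [Finset.mul_prod_erase _ _ (by simp [hlj, hlk]), mul_assoc,
      Finset.mul_prod_erase _ _ (by simp [hjk.symm]), Finset.mul_prod_erase _ _ (by simp), hprod]
  rw [e, mul_div_cancel_left₀ _ (mul_ne_zero (h0 j) (h0 k))]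
  refine norm_mul_lt_one_of_le (ht l) ?_
  rw [norm_prod]
  exact Finset.prod_le_one (fun _ _ => norm_nonneg _) fun i _ => (ht i).le

theorem gammaPairProd_ne_zero (hp : ‖p‖ < 1) (hq : ‖q‖ < 1) (hp0 : p ≠ 0) (hq0 : q ≠ 0)
    {t : Fin 6 → ℂ} (ht : t ∈ betaDomain p q) : gammaPairProd p q t ≠ 0 :=
  Finset.prod_ne_zero_iff.2 fun j _ => Finset.prod_ne_zero_iff.2 fun k hk =>
    ellGamma_ne_zero hp hq (norm_mul_lt_one (ht.1 j) (ht.1 k))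
      (norm_div_mul_lt_one (mul_ne_zero hp0 hq0) ht.1 ht.2 (Finset.mem_Ioi.1 hk).ne)

theorem gammaPairProd_vec (a b d x y u : ℂ) :
    gammaPairProd p q ![a, b, d, x, y, u] =
      (ellGamma (a * b) p q * ellGamma (a * d) p q * ellGamma (a * x) p q *
        ellGamma (a * y) p q) * ellGamma (a * u) p q *
      (ellGamma (b * u) p q * ellGamma (d * u) p q * ellGamma (x * u) p q *
        ellGamma (y * u) p q) *
      (ellGamma (b * d) p q * ellGamma (b * x) p q * ellGamma (b * y) p q *
        ellGamma (d * x) p q * ellGamma (d * y) p q * ellGamma (x * y) p q) := by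
  have h0 : Finset.Ioi (0 : Fin 6) = {1, 2, 3, 4, 5} := by decide
  have h1 : Finset.Ioi (1 : Fin 6) = {2, 3, 4, 5} := by decide
  have h2 : Finset.Ioi (2 : Fin 6) = {3, 4, 5} := by decide
  have h3 : Finset.Ioi (3 : Fin 6) = {4, 5} := by decide
  have h4 : Finset.Ioi (4 : Fin 6) = {5} := by decide
  have h5 : Finset.Ioi (5 : Fin 6) = ∅ := by decide
  rw [gammaPairProd, Fin.prod_univ_six, h0, h1, h2, h3, h4, h5]
  simp [Finset.prod_insert]
  ring

theorem betaRatio_swap (a b d x y u : ℂ) :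
    betaRatio p q ![a, b, d, x, y, u] = betaRatio p q ![b, a, d, x, y, u] := by
  have h : ellBetaIntegrand ![a, b, d, x, y, u] p q = ellBetaIntegrand ![b, a, d, x, y, u] p q := by
    funext z
    simp only [ellBetaIntegrand, Fin.prod_univ_six, Matrix.cons_val]
    ring
  rw [betaRatio, betaRatio, h, gammaPairProd_vec, gammaPairProd_vec, mul_comm b a]
  ring

/-- Γ(qvw) = θ(vw) Γ(vw) produces exactly the theta factors of
`circleAverage_ellBetaIntegrand_shift`; the factor Γ(qau) is common to both sides. -/
theorem betaRatio_shift (hp : ‖p‖ < 1) (hq : ‖q‖ < 1) (hp0 : p ≠ 0) (hq0 : q ≠ 0)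
    {a b d x y u : ℂ} (ha : ‖a‖ < 1) (hb : ‖b‖ < 1) (hd : ‖d‖ < 1) (hx : ‖x‖ < 1) (hy : ‖y‖ < 1)
    (hu : ‖u‖ < 1) (hprod : a * b * d * x * y * u = p) :
    betaRatio p q ![a, b, d, x, y, q * u] = betaRatio p q ![q * a, b, d, x, y, u] := by
  have key := circleAverage_ellBetaIntegrand_shift hp hq hp0 hq0 ha hb hd hx hy hu hprod
  have hne : a * b * d * x * y * u ≠ 0 := hprod ▸ hp0
  simp only [mul_ne_zero_iff] at hne
  obtain ⟨⟨⟨⟨⟨ha0, hb0⟩, hd0⟩, hx0⟩, hy0⟩, hu0⟩ := hne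
  have hqu := norm_mul_lt_one hq hu
  have hqa := norm_mul_lt_one hq ha
  have n1 := gammaPairProd_ne_zero (t := ![a, b, d, x, y, q * u]) hp hq hp0 hq0
    ⟨forall_vecSix (P := fun w => ‖w‖ < 1) ha hb hd hx hy hqu, by
      simp only [Fin.prod_univ_six, Matrix.cons_val]; rw [← hprod]; ring⟩
  have n2 := gammaPairProd_ne_zero (t := ![q * a, b, d, x, y, u]) hp hq hp0 hq0
    ⟨forall_vecSix (P := fun w => ‖w‖ < 1) hqa hb hd hx hy hu, by
      simp only [Fin.prod_univ_six, Matrix.cons_val]; rw [← hprod]; ring⟩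
  have hΓ : ∀ {v w : ℂ}, v ≠ 0 → w ≠ 0 → ‖v‖ < 1 → ‖w‖ < 1 →
      ellGamma (q * v * w) p q = qTheta p (v * w) * ellGamma (v * w) p q := fun hv hw hv' hw' => by
    rw [mul_assoc, ellGamma_mul_left hp hq hp0 hq0 (mul_ne_zero hv hw) (norm_mul_lt_one hv' hw')]
  have hΓ' : ∀ {v w : ℂ}, v ≠ 0 → w ≠ 0 → ‖v‖ < 1 → ‖w‖ < 1 →
      ellGamma (v * (q * w)) p q = qTheta p (w * v) * ellGamma (v * w) p q :=
    fun {v w} hv hw hv' hw' => by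
    rw [show v * (q * w) = q * w * v by ring, hΓ hw hv hw' hv', mul_comm w v]
  rw [betaRatio, betaRatio, div_eq_div_iff n1 n2, gammaPairProd_vec, gammaPairProd_vec,
    hΓ ha0 hb0 ha hb, hΓ ha0 hd0 ha hd, hΓ ha0 hx0 ha hx, hΓ ha0 hy0 ha hy, hΓ ha0 hu0 ha hu,
    hΓ' ha0 hu0 ha hu, hΓ' hb0 hu0 hb hu, hΓ' hd0 hu0 hd hu, hΓ' hx0 hu0 hx hu,
    hΓ' hy0 hu0 hy hu, mul_comm u a]
  linear_combination (ellGamma (a * b) p q * ellGamma (a * d) p q * ellGamma (a * x) p q *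
        ellGamma (a * y) p q) * (qTheta p (a * u) * ellGamma (a * u) p q) *
      (ellGamma (b * u) p q * ellGamma (d * u) p q * ellGamma (x * u) p q *
        ellGamma (y * u) p q) *
      (ellGamma (b * d) p q * ellGamma (b * x) p q * ellGamma (b * y) p q *
        ellGamma (d * x) p q * ellGamma (d * y) p q * ellGamma (x * y) p q) * key

theorem differentiableOn_betaRatio (hp : ‖p‖ < 1) (hq : ‖q‖ < 1) (hp0 : p ≠ 0) (hq0 : q ≠ 0)
    {V : Set ℂ} (hV : IsOpen V) {τ : ℂ → Fin 6 → ℂ}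
    (hτ : ∀ k, DifferentiableOn ℂ (fun s => τ s k) V) (hτD : ∀ s ∈ V, τ s ∈ betaDomain p q) :
    DifferentiableOn ℂ (fun s => betaRatio p q (τ s)) V := by
  have hpq := mul_ne_zero hp0 hq0
  have h0 : ∀ s ∈ V, ∀ k, τ s k ≠ 0 := fun s hs k => ne_zero_of_prod_eq hpq (hτD s hs).2 k
  have hΓ : ∀ {g : ℂ → ℂ}, DifferentiableOn ℂ g V → (∀ s ∈ V, g s ≠ 0) → (∀ s ∈ V, ‖g s‖ < 1) →
      DifferentiableOn ℂ (fun s => ellGamma (g s) p q) V := fun hg hg0 hg1 s hs =>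
    (differentiableAt_ellGamma hp hq (hg0 s hs) (hg1 s hs)).comp_differentiableWithinAt s (hg s hs)
  have hΓc : ContinuousOn (fun x => ellGamma x p q) {x | x ≠ 0 ∧ ‖x‖ < 1} := fun x hx =>
    (differentiableAt_ellGamma hp hq hx.1 hx.2).continuousAt.continuousWithinAt
  refine DifferentiableOn.div ?_ ?_ fun s hs => gammaPairProd_ne_zero hp hq hp0 hq0 (hτD s hs)
  · have hF := differentiableOn_circleAverage hV
      (F := fun s z => (∏ k, gammaPair p q (τ s k) z) * thetaWeight p q z) ?_ ?_
    · exact hF.congr fun s _ => circleAverage_congr_sphere fun z hz =>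
        ellBetaIntegrand_eq hp hq _ (by simpa using hz)
    · refine ContinuousOn.mul (continuousOn_finsetProd _ fun k _ => ContinuousOn.mul ?_ ?_) ?_
      · refine hΓc.comp (f := fun x : ℂ × ℂ => τ x.1 k * x.2) ?_ ?_
        · exact ((hτ k).continuousOn.comp continuousOn_fst fun x hx => hx.1).mul continuousOn_snd
        · rintro ⟨s, z⟩ ⟨hs, hz⟩
          have hz1 : ‖z‖ = 1 := by simpa using hz
          exact ⟨mul_ne_zero (h0 s hs k) (ne_zero_of_norm_eq_one hz1),
            norm_mul_lt_one_of_le ((hτD s hs).1 k) hz1.le⟩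
      · refine hΓc.comp (f := fun x : ℂ × ℂ => τ x.1 k * x.2⁻¹) ?_ ?_
        · exact ((hτ k).continuousOn.comp continuousOn_fst fun x hx => hx.1).mul
            (continuousOn_snd.inv₀ fun x hx => ne_zero_of_norm_eq_one (by simpa using hx.2))
        · rintro ⟨s, z⟩ ⟨hs, hz⟩
          have hz1 : ‖z‖ = 1 := by simpa using hz
          exact ⟨mul_ne_zero (h0 s hs k) (inv_ne_zero (ne_zero_of_norm_eq_one hz1)),
            norm_mul_lt_one_of_le ((hτD s hs).1 k) (by simp [hz1])⟩
      · rintro ⟨s, z⟩ ⟨hs, hz⟩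
        exact ((differentiableAt_thetaWeight hp hq
          (ne_zero_of_norm_eq_one (by simpa using hz))).continuousAt.comp
          (f := fun x : ℂ × ℂ => x.2) continuousAt_snd).continuousWithinAt
    · intro z hz
      have hz1 : ‖z‖ = 1 := by simpa using hz
      have hz0 := ne_zero_of_norm_eq_one hz1
      refine DifferentiableOn.mul_const (DifferentiableOn.fun_finsetProd fun k _ =>
        DifferentiableOn.mul ?_ ?_) _
      · exact hΓ ((hτ k).mul_const z) (fun s hs => mul_ne_zero (h0 s hs k) hz0) fun s hs =>
          norm_mul_lt_one_of_le ((hτD s hs).1 k) hz1.le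
      · exact hΓ ((hτ k).mul_const z⁻¹) (fun s hs => mul_ne_zero (h0 s hs k) (inv_ne_zero hz0))
          fun s hs => norm_mul_lt_one_of_le ((hτD s hs).1 k) (by simp [hz1])
  · exact DifferentiableOn.fun_finsetProd fun j _ => DifferentiableOn.fun_finsetProd fun k _ =>
      hΓ ((hτ j).mul (hτ k)) (fun s hs => mul_ne_zero (h0 s hs j) (h0 s hs k)) fun s hs =>
        norm_mul_lt_one ((hτD s hs).1 j) ((hτD s hs).1 k)

end Ratio

/-! ### Multiplicatively periodic holomorphic functions on an annulus. -/

section Periodic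

theorem isPreconnected_annulus {r : ℝ} (hr : 0 < r) :
    IsPreconnected {s : ℂ | r < ‖s‖ ∧ ‖s‖ < 1} := by
  have h1 : Convex ℝ {w : ℂ | Real.log r < w.re ∧ w.re < 0} :=
    (convex_Ioo (Real.log r) 0).linear_preimage Complex.reLm
  have h2 : Complex.exp '' {w : ℂ | Real.log r < w.re ∧ w.re < 0} =
      {s : ℂ | r < ‖s‖ ∧ ‖s‖ < 1} := by
    ext s
    constructor
    · rintro ⟨w, ⟨h1, h2⟩, rfl⟩
      rw [Set.mem_ofPred_eq, Complex.norm_exp]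
      exact ⟨(Real.log_lt_iff_lt_exp hr).1 h1, by simpa using h2⟩
    · rintro ⟨h1, h2⟩
      have hs : s ≠ 0 := norm_pos_iff.1 (hr.trans h1)
      refine ⟨Complex.log s, ?_, Complex.exp_log hs⟩
      rw [Set.mem_ofPred_eq, Complex.log_re]
      exact ⟨Real.log_lt_log hr h1, Real.log_neg (hr.trans h1) h2⟩
  rw [← h2]
  exact h1.isPreconnected.image _ Complex.continuous_exp.continuousOn

/-- A holomorphic function on an annulus which is invariant under multiplication by `q` is constant
if the annulus contains a fundamental domain. -/
theorem eq_of_mul_periodic {q : ℂ} (hq0 : q ≠ 0) {F : ℂ → ℂ} {a r : ℝ}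
    (hF : DifferentiableOn ℂ F {s | a < ‖s‖ ∧ ‖s‖ < 1})
    (hper : ∀ s, a < ‖q * s‖ → ‖s‖ < 1 → F (q * s) = F s) (hqr : ‖q‖ ≤ r) (hr : r < 1)
    (har : a < r * ‖q‖) {s₁ s₂ : ℂ} (h₁ : r * ‖q‖ < ‖s₁‖ ∧ ‖s₁‖ < 1)
    (h₂ : r * ‖q‖ < ‖s₂‖ ∧ ‖s₂‖ < 1) : F s₁ = F s₂ := by
  have hqp : 0 < ‖q‖ := norm_pos_iff.2 hq0
  have hrp : 0 < r := hqp.trans_le hqr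
  have hrq : r * ‖q‖ < r := mul_lt_of_lt_one_right hrp (hqr.trans_lt hr)
  set U : Set ℂ := {s | r * ‖q‖ < ‖s‖ ∧ ‖s‖ < 1} with hU
  set K : Set ℂ := {s | r * ‖q‖ ≤ ‖s‖ ∧ ‖s‖ ≤ r} with hK
  have hUo : IsOpen U :=
    (isOpen_lt continuous_const continuous_norm).inter (isOpen_lt continuous_norm continuous_const)
  have hKc : IsCompact K := by
    refine (isCompact_closedBall (0 : ℂ) r).of_isClosed_subset
      ((isClosed_le continuous_const continuous_norm).inter
        (isClosed_le continuous_norm continuous_const)) fun s hs => ?_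
    simpa using hs.2
  have hKne : K.Nonempty := ⟨(r : ℂ), by
    simp only [hK, Set.mem_ofPred_eq, Complex.norm_real, norm_of_nonneg hrp.le]
    exact ⟨hrq.le, le_rfl⟩⟩
  have hUd : DifferentiableOn ℂ F U := hF.mono fun s hs => ⟨har.trans hs.1, hs.2⟩
  have hKF : ContinuousOn (fun s => ‖F s‖) K :=
    (hF.continuousOn.mono fun s hs => ⟨har.trans_le hs.1, hs.2.trans_lt hr⟩).norm
  obtain ⟨s₀, hs₀, hmax⟩ := hKc.exists_isMaxOn hKne hKF
  -- K is a closed fundamental domain, so its maximum bounds F on all of U: points with |s| > r are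
  -- moved into K by multiplication by q.
  have hUmax : ∀ s ∈ U, ‖F s‖ ≤ ‖F s₀‖ := by
    intro s hs
    rcases le_or_gt ‖s‖ r with h | h
    · exact hmax (a := s) ⟨hs.1.le, h⟩
    · have hqs : q * s ∈ K := by
        rw [hK, Set.mem_ofPred_eq, norm_mul]
        constructor
        · rw [mul_comm]; gcongr
        · exact (mul_le_of_le_one_right hqp.le hs.2.le).trans hqr
      rw [← hper s (har.trans_le hqs.1) hs.2]
      exact hmax hqs
  -- If the maximum sits on the inner circle, outside the open set U, its translate s₀/q lies on |s|
  -- = r, inside U.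
  obtain ⟨c, hcU, hc⟩ : ∃ c ∈ U, F c = F s₀ := by
    rcases hs₀.1.lt_or_eq with h | h
    · exact ⟨s₀, ⟨h, hs₀.2.trans_lt hr⟩, rfl⟩
    · have e : q * (s₀ / q) = s₀ := mul_div_cancel₀ s₀ hq0
      have hn : ‖s₀ / q‖ = r := by rw [norm_div, ← h, mul_div_cancel_right₀ _ hqp.ne']
      refine ⟨s₀ / q, ⟨by rwa [hn], by rwa [hn]⟩, ?_⟩
      rw [← hper (s₀ / q) (by rw [e, ← h]; exact har) (by rwa [hn]), e]
  have hconst := Complex.eqOn_of_isPreconnected_of_isMaxOn_norm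
    (isPreconnected_annulus (mul_pos hrp hqp)) hUo hUd hcU
    (fun s hs => by simpa [hc] using hUmax s hs)
  exact (hconst h₁).trans (hconst h₂).symm

end Periodic

/-! ### Poisson kernel in z² and its concentration at ±i. -/

section Poisson

theorem norm_circleAverage_le {f : ℂ → ℂ} {g : ℂ → ℝ} (hg : CircleIntegrable g 0 1)
    (h : ∀ z, ‖z‖ = 1 → ‖f z‖ ≤ g z) : ‖circleAverage f 0 1‖ ≤ circleAverage g 0 1 := by
  rw [circleAverage, circleAverage, norm_smul, smul_eq_mul, norm_of_nonneg (by positivity)]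
  gcongr
  exact intervalIntegral.norm_integral_le_of_norm_le two_pi_pos.le
    (.of_forall fun θ _ => h _ (by simp)) hg

/-- The Poisson kernel of the unit disc at `-ρ ^ 2`, in the variable `z ^ 2`. -/
noncomputable def sqPoisson (ρ : ℝ) (z : ℂ) : ℝ := (1 - ρ ^ 4) / ‖1 + (ρ : ℂ) ^ 2 * z ^ 2‖ ^ 2

theorem norm_sq_mul_sq_lt_one {ρ : ℝ} (h0 : 0 < ρ) (h1 : ρ < 1) {z : ℂ} (hz : ‖z‖ ≤ 1) :
    ‖-((ρ : ℂ) ^ 2 * z ^ 2)‖ < 1 := by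
  rw [norm_neg, ← mul_pow, norm_pow, norm_mul, Complex.norm_real, norm_of_nonneg h0.le]
  have : ρ * ‖z‖ < 1 := mul_lt_one_of_nonneg_of_lt_one_left h0.le h1 hz
  exact pow_lt_one₀ (by positivity) this two_ne_zero

theorem one_add_sq_mul_sq_ne_zero {ρ : ℝ} (h0 : 0 < ρ) (h1 : ρ < 1) {z : ℂ} (hz : ‖z‖ ≤ 1) :
    1 + (ρ : ℂ) ^ 2 * z ^ 2 ≠ 0 := by
  simpa using one_sub_ne_zero_of_norm_lt_one (norm_sq_mul_sq_lt_one h0 h1 hz)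

theorem ofReal_sqPoisson (ρ : ℝ) {z : ℂ} (hz : ‖z‖ = 1) :
    (sqPoisson ρ z : ℂ) =
      (1 - (ρ : ℂ) ^ 4) / ((1 + (ρ : ℂ) ^ 2 * z ^ 2) * (1 + (ρ : ℂ) ^ 2 * z⁻¹ ^ 2)) := by
  have hconj : (1 + (ρ : ℂ) ^ 2 * z⁻¹ ^ 2) = (starRingEnd ℂ) (1 + (ρ : ℂ) ^ 2 * z ^ 2) := by
    simp [Complex.inv_eq_conj hz]
  rw [hconj, Complex.mul_conj, Complex.normSq_eq_norm_sq, sqPoisson]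
  push_cast
  rfl

theorem continuousOn_sqPoisson {ρ : ℝ} (h0 : 0 < ρ) (h1 : ρ < 1) :
    ContinuousOn (sqPoisson ρ) (Metric.sphere 0 1) := by
  refine ContinuousOn.div continuousOn_const (by fun_prop) fun z hz => ?_
  have hz1 : ‖z‖ = 1 := by simpa using hz
  exact pow_ne_zero 2 (norm_ne_zero_iff.2 (one_add_sq_mul_sq_ne_zero h0 h1 hz1.le))

theorem circleIntegrable_sqPoisson {ρ : ℝ} (h0 : 0 < ρ) (h1 : ρ < 1) :
    CircleIntegrable (sqPoisson ρ) 0 1 :=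
  (continuousOn_sqPoisson h0 h1).circleIntegrable zero_le_one

/-- On the circle the kernel is A(z) + A(1/z) - 1, with A holomorphic on the closed disc and A(0) =
1. -/
theorem circleAverage_ofReal_sqPoisson {ρ : ℝ} (h0 : 0 < ρ) (h1 : ρ < 1) :
    circleAverage (fun z => (sqPoisson ρ z : ℂ)) 0 1 = 1 := by
  set A : ℂ → ℂ := fun z => (1 + (ρ : ℂ) ^ 2 * z ^ 2)⁻¹ with hA
  have hd : ∀ z, ‖z‖ ≤ 1 → DifferentiableAt ℂ A z := fun z hz =>
    DifferentiableAt.inv (by fun_prop) (one_add_sq_mul_sq_ne_zero h0 h1 hz)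
  have havg : circleAverage A 0 1 = 1 := by
    rw [circleAverage_of_differentiable_on_off_countable Set.countable_empty
      (fun z hz => (hd z (by simpa using hz)).continuousAt.continuousWithinAt)
      (fun z hz => hd z (by simpa using (Metric.ball_subset_closedBall hz.1)))]
    simp [hA]
  have i1 : CircleIntegrable A 0 1 := ContinuousOn.circleIntegrable zero_le_one fun z hz =>
    (hd z (by simpa using hz.le)).continuousAt.continuousWithinAt
  have i2 : CircleIntegrable (fun z => A z⁻¹) 0 1 :=
    ContinuousOn.circleIntegrable zero_le_one fun z hz => by
      have hz1 : ‖z‖ = 1 := by simpa using hz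
      exact ((hd z⁻¹ (by simp [hz1])).continuousAt.comp (f := fun z : ℂ => z⁻¹)
        (continuousAt_inv₀ (ne_zero_of_norm_eq_one hz1))).continuousWithinAt
  have i3 : CircleIntegrable (fun _ : ℂ => (1 : ℂ)) 0 1 := circleIntegrable_const _ _ _
  have e : circleAverage (fun z => (sqPoisson ρ z : ℂ)) 0 1 =
      circleAverage (A + (fun z => A z⁻¹) - fun _ => 1) 0 1 := by
    refine circleAverage_congr_sphere fun z hz => ?_
    have hz1 : ‖z‖ = 1 := by simpa using hz
    have hz0 := ne_zero_of_norm_eq_one hz1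
    have n1 := one_add_sq_mul_sq_ne_zero h0 h1 hz1.le
    have n2 := one_add_sq_mul_sq_ne_zero h0 h1 (z := z⁻¹) (by simp [hz1])
    simp only [ofReal_sqPoisson ρ hz1, hA, Pi.sub_apply, Pi.add_apply]
    have e3 : z ^ 2 * z⁻¹ ^ 2 = 1 := by field_simp
    generalize z⁻¹ ^ 2 = w at *
    field_simp
    linear_combination ((ρ : ℂ) ^ 4) * e3
  rw [e, circleAverage_sub (i1.add i2) i3, circleAverage_add i1 i2,
    circleAverage_zero_one_congr_inv, havg, circleAverage_const]
  ring

theorem circleAverage_sqPoisson {ρ : ℝ} (h0 : 0 < ρ) (h1 : ρ < 1) :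
    circleAverage (sqPoisson ρ) 0 1 = 1 := by
  have h := Complex.ofRealCLM.circleAverage_comp_comm (circleIntegrable_sqPoisson h0 h1)
  have h2 := circleAverage_ofReal_sqPoisson h0 h1
  rw [show (fun z => (sqPoisson ρ z : ℂ)) = Complex.ofRealCLM ∘ sqPoisson ρ from rfl, h,
    Complex.ofRealCLM_apply] at h2
  exact_mod_cast h2

theorem sqPoisson_nonneg {ρ : ℝ} (h0 : 0 < ρ) (h1 : ρ < 1) (z : ℂ) : 0 ≤ sqPoisson ρ z :=
  div_nonneg (sub_nonneg.2 (pow_le_one₀ h0.le h1.le)) (by positivity)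

theorem sqPoisson_le {ρ η : ℝ} (h0 : 0 < ρ) (h1 : ρ < 1) (hη : 0 < η) (hρη : 1 - ρ ^ 2 ≤ η / 2)
    {z : ℂ} (hz : ‖z‖ = 1) (hzη : η ≤ ‖1 + z ^ 2‖) :
    sqPoisson ρ z ≤ 4 / η ^ 2 * (1 - ρ ^ 4) := by
  have h : η / 2 ≤ ‖1 + (ρ : ℂ) ^ 2 * z ^ 2‖ := by
    have e : 1 + z ^ 2 = (1 + (ρ : ℂ) ^ 2 * z ^ 2) + ((1 - ρ ^ 2 : ℝ) : ℂ) * z ^ 2 := by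
      push_cast; ring
    have h2 : ‖((1 - ρ ^ 2 : ℝ) : ℂ) * z ^ 2‖ = 1 - ρ ^ 2 := by
      rw [norm_mul, norm_pow, hz, Complex.norm_real,
        norm_of_nonneg (sub_nonneg.2 (pow_le_one₀ h0.le h1.le))]
      ring
    have h3 := norm_add_le (1 + (ρ : ℂ) ^ 2 * z ^ 2) (((1 - ρ ^ 2 : ℝ) : ℂ) * z ^ 2)
    rw [← e, h2] at h3
    linarith
  have h4 : 0 ≤ 1 - ρ ^ 4 := sub_nonneg.2 (pow_le_one₀ h0.le h1.le)
  calc sqPoisson ρ z ≤ (1 - ρ ^ 4) / (η / 2) ^ 2 := by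
        unfold sqPoisson
        gcongr
    _ = 4 / η ^ 2 * (1 - ρ ^ 4) := by field_simp; ring

/-- Poisson averages of a continuous family concentrate at the points `z = ± i`. -/
theorem tendsto_circleAverage_mul_sqPoisson {H : ℝ → ℂ → ℂ} {ρ₀ : ℝ} (h₀ : 0 < ρ₀) (h₁ : ρ₀ < 1)
    (hH : ContinuousOn (Function.uncurry H) (Set.Icc ρ₀ 1 ×ˢ Metric.sphere 0 1)) {L : ℂ}
    (hI : H 1 Complex.I = L) (hI' : H 1 (-Complex.I) = L) :
    Tendsto (fun ρ => circleAverage (fun z => H ρ z * (sqPoisson ρ z : ℂ)) 0 1) (𝓝[<] 1) (𝓝 L) := by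
  obtain ⟨M, hM⟩ := ((isCompact_Icc.prod (isCompact_sphere (0 : ℂ) 1)).image_of_continuousOn
    (hH.sub (continuousOn_const (c := L)))).isBounded.exists_norm_le
  have hM' : ∀ ρ ∈ Set.Icc ρ₀ 1, ∀ z : ℂ, ‖z‖ = 1 → ‖H ρ z - L‖ ≤ M := fun ρ hρ z hz =>
    hM _ ⟨(ρ, z), ⟨hρ, by simpa using hz⟩, rfl⟩
  have hM0 : 0 ≤ M := (norm_nonneg _).trans (hM' 1 ⟨h₁.le, le_rfl⟩ 1 (by simp))
  rw [Metric.tendsto_nhds]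
  intro ε hε
  have hnear : ∀ w : ℂ, ‖w‖ = 1 → H 1 w = L → ∃ δ > 0, ∀ ρ ∈ Set.Icc ρ₀ 1, ∀ z : ℂ, ‖z‖ = 1 →
      1 - ρ < δ → ‖z - w‖ < δ → ‖H ρ z - L‖ ≤ ε / 2 := by
    intro w hw hwL
    obtain ⟨δ, hδ, h⟩ := Metric.continuousWithinAt_iff.1
      (hH (1, w) ⟨⟨h₁.le, le_rfl⟩, by simpa using hw⟩) (ε / 2) (by positivity)
    refine ⟨δ, hδ, fun ρ hρ z hz h1 h2 => ?_⟩
    have := h (x := (ρ, z)) ⟨hρ, by simpa using hz⟩ (by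
      rw [Prod.dist_eq, max_lt_iff, Real.dist_eq, abs_sub_comm,
        abs_of_nonneg (sub_nonneg.2 hρ.2), dist_eq_norm]
      exact ⟨h1, h2⟩)
    rw [dist_eq_norm] at this
    simpa [Function.uncurry, hwL] using this.le
  -- The value L is the same at both points, so how the mass divides between them is irrelevant.
  obtain ⟨δ₁, hδ₁, hn₁⟩ := hnear Complex.I (by simp) hI
  obtain ⟨δ₂, hδ₂, hn₂⟩ := hnear (-Complex.I) (by simp) hI'
  set δ := min δ₁ δ₂ with hδ
  have hδ0 : 0 < δ := lt_min hδ₁ hδ₂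
  set η := δ ^ 2 with hη
  have hη0 : 0 < η := by positivity
  have ev1 : ∀ᶠ ρ : ℝ in 𝓝[<] 1, 1 - ρ ^ 2 < η / 2 := by
    have : Tendsto (fun ρ : ℝ => 1 - ρ ^ 2) (𝓝[<] 1) (𝓝 (1 - 1 ^ 2)) :=
      (Continuous.tendsto (by fun_prop) 1).mono_left nhdsWithin_le_nhds
    exact this.eventually_lt_const (by norm_num; positivity)
  have ev2 : ∀ᶠ ρ : ℝ in 𝓝[<] 1, M * (4 / η ^ 2 * (1 - ρ ^ 4)) < ε / 2 := by
    have : Tendsto (fun ρ : ℝ => M * (4 / η ^ 2 * (1 - ρ ^ 4))) (𝓝[<] 1)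
        (𝓝 (M * (4 / η ^ 2 * (1 - 1 ^ 4)))) :=
      (Continuous.tendsto (by fun_prop) 1).mono_left nhdsWithin_le_nhds
    exact this.eventually_lt_const (by norm_num; positivity)
  have ev3 : ∀ᶠ ρ : ℝ in 𝓝[<] 1, 1 - ρ < δ := by
    have : Tendsto (fun ρ : ℝ => 1 - ρ) (𝓝[<] 1) (𝓝 (1 - 1)) :=
      (Continuous.tendsto (by fun_prop) 1).mono_left nhdsWithin_le_nhds
    exact this.eventually_lt_const (by simpa using hδ0)
  have ev4 : ∀ᶠ ρ : ℝ in 𝓝[<] 1, ρ ∈ Set.Ioo ρ₀ 1 := Ioo_mem_nhdsLT h₁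
  filter_upwards [ev1, ev2, ev3, ev4] with ρ e1 e2 e3 e4
  have hρ0 : 0 < ρ := h₀.trans e4.1
  have hρI : ρ ∈ Set.Icc ρ₀ 1 := ⟨e4.1.le, e4.2.le⟩
  have hPc : ContinuousOn (fun z => (sqPoisson ρ z : ℂ)) (Metric.sphere 0 1) :=
    Complex.continuous_ofReal.comp_continuousOn (continuousOn_sqPoisson hρ0 e4.2)
  have hHc : ContinuousOn (H ρ) (Metric.sphere 0 1) :=
    hH.comp (f := fun z : ℂ => (ρ, z)) (by fun_prop) fun z hz => ⟨hρI, hz⟩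
  have i1 : CircleIntegrable (fun z => H ρ z * (sqPoisson ρ z : ℂ)) 0 1 :=
    (hHc.mul hPc).circleIntegrable zero_le_one
  have i2 : CircleIntegrable (L • fun z => (sqPoisson ρ z : ℂ)) 0 1 :=
    (hPc.circleIntegrable zero_le_one).const_smul
  have hL : L = circleAverage (L • fun z => (sqPoisson ρ z : ℂ)) 0 1 := by
    rw [circleAverage_smul, circleAverage_ofReal_sqPoisson hρ0 e4.2, smul_eq_mul, mul_one]
  rw [dist_eq_norm]
  conv_lhs => rw [hL]
  rw [← circleAverage_sub i1 i2]
  have ig : CircleIntegrable ((ε / 2) • sqPoisson ρ) 0 1 :=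
    (circleIntegrable_sqPoisson hρ0 e4.2).const_smul
  have ic : CircleIntegrable (fun _ : ℂ => M * (4 / η ^ 2 * (1 - ρ ^ 4))) 0 1 :=
    circleIntegrable_const _ _ _
  have hbound := norm_circleAverage_le (f := (fun z => H ρ z * (sqPoisson ρ z : ℂ)) -
      L • fun z => (sqPoisson ρ z : ℂ))
    (g := (ε / 2) • sqPoisson ρ + fun _ => M * (4 / η ^ 2 * (1 - ρ ^ 4))) (ig.add ic) (by
      intro z hz
      have hP := sqPoisson_nonneg hρ0 e4.2 z
      have hc : 0 ≤ M * (4 / η ^ 2 * (1 - ρ ^ 4)) := by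
        have : 0 ≤ 1 - ρ ^ 4 := sub_nonneg.2 (pow_le_one₀ hρ0.le e4.2.le)
        positivity
      simp only [Pi.sub_apply, Pi.add_apply, Pi.smul_apply, smul_eq_mul]
      rw [← sub_mul, norm_mul, Complex.norm_real, norm_of_nonneg hP]
      rcases lt_or_ge ‖1 + z ^ 2‖ η with h | h
      · have hle : ‖H ρ z - L‖ ≤ ε / 2 := by
          -- If |z - i| |z + i| < δ², one of the factors is below δ; this is why η = δ².
          have hfac : 1 + z ^ 2 = (z - Complex.I) * (z - -Complex.I) := by
            linear_combination Complex.I_sq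
          rw [hfac, norm_mul, hη, pow_two] at h
          rcases lt_or_ge ‖z - Complex.I‖ δ with h' | h'
          · exact hn₁ ρ hρI z hz (e3.trans_le (min_le_left _ _)) (h'.trans_le (min_le_left _ _))
          · have h'' : ‖z - -Complex.I‖ < δ := by
              by_contra! hcon
              exact absurd h (not_lt.2 (mul_le_mul h' hcon hδ0.le (norm_nonneg _)))
            exact hn₂ ρ hρI z hz (e3.trans_le (min_le_right _ _))
              (h''.trans_le (min_le_right _ _))
        have := mul_le_mul_of_nonneg_right hle hP
        linarith
      · have h1 := mul_le_mul (hM' ρ hρI z hz) (sqPoisson_le hρ0 e4.2 hη0 e1.le hz h) hP hM0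
        have : 0 ≤ ε / 2 * sqPoisson ρ z := by positivity
        linarith)
  rw [circleAverage_add ig ic, circleAverage_smul, circleAverage_sqPoisson hρ0 e4.2,
    circleAverage_const, smul_eq_mul, mul_one] at hbound
  linarith

end Poisson

/-! ### The pinching limit. -/

section Regularized

variable {p q : ℂ}

/-- The regularization `(1 - x) Γ(x)` of the elliptic gamma function at `x = 1`. -/
noncomputable def gammaReg (p q x : ℂ) : ℂ :=
  dblPoch p q (p * q / x) / (qPochInf (p * x) p * qPochInf (q * x) q * dblPoch p q (p * q * x))

theorem gammaReg_denom_ne_zero (hp : ‖p‖ < 1) (hq : ‖q‖ < 1) {x : ℂ} (hx : ‖x‖ ≤ 1) :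
    qPochInf (p * x) p * qPochInf (q * x) q * dblPoch p q (p * q * x) ≠ 0 :=
  mul_ne_zero (mul_ne_zero (qPochInf_ne_zero hp (norm_mul_lt_one_of_le hp hx))
    (qPochInf_ne_zero hq (norm_mul_lt_one_of_le hq hx)))
    (dblPoch_ne_zero hp hq (norm_mul_lt_one_of_le (norm_mul_lt_one hp hq) hx))

theorem one_sub_mul_ellGamma (hp : ‖p‖ < 1) (hq : ‖q‖ < 1) {x : ℂ} (h1 : x ≠ 1) :
    (1 - x) * ellGamma x p q = gammaReg p q x := by
  have h1' : 1 - x ≠ 0 := sub_ne_zero.2 h1.symm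
  rw [ellGamma_eq hp hq, gammaReg, dblPoch_eq_mul_right hp hq x, qPochInf_eq_mul hp x,
    dblPoch_eq_mul_left hp hq (q * x), ← mul_assoc p q x, mul_div_assoc', mul_assoc (1 - x),
    mul_div_mul_left _ _ h1', mul_assoc (qPochInf (p * x) p)]

theorem continuousAt_gammaReg (hp : ‖p‖ < 1) (hq : ‖q‖ < 1) {x : ℂ} (h0 : x ≠ 0) (hx : ‖x‖ ≤ 1) :
    ContinuousAt (gammaReg p q) x := by
  have hE := (differentiable_dblPoch hp hq).continuous
  have hP := (differentiable_qPochInf hp).continuous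
  have hQ := (differentiable_qPochInf hq).continuous
  refine ContinuousAt.div ?_ ?_ (gammaReg_denom_ne_zero hp hq hx)
  · exact hE.continuousAt.comp (f := fun x => p * q / x)
      (continuousAt_const.div continuousAt_id h0)
  · exact (((hP.comp (continuous_const_mul p)).mul (hQ.comp (continuous_const_mul q))).mul
      (hE.comp (continuous_const_mul (p * q)))).continuousAt

theorem gammaReg_one (hp : ‖p‖ < 1) (hq : ‖q‖ < 1) :
    gammaReg p q 1 = (qPochInf p p * qPochInf q q)⁻¹ := by
  have h := dblPoch_ne_zero hp hq (norm_mul_lt_one hp hq)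
  rw [gammaReg, div_one, mul_one, mul_one, mul_one]
  field_simp

theorem gammaReg_one_ne_zero (hp : ‖p‖ < 1) (hq : ‖q‖ < 1) : gammaReg p q 1 ≠ 0 := by
  rw [gammaReg_one hp hq]
  exact inv_ne_zero (mul_ne_zero (qPochInf_ne_zero hp hp) (qPochInf_ne_zero hq hq))

/-- The regularized value at -1 is 2Γ(-1), and Γ(-1)² is the inverse of the theta product. -/
theorem gammaReg_neg_one_sq_mul (hp : ‖p‖ < 1) (hq : ‖q‖ < 1) :
    gammaReg p q (-1) ^ 2 * (qTheta p (-1) * qTheta q (-1)) = 4 := by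
  have hW := inv_ellGamma_mul_ellGamma_inv hp hq (x := -1) (by simp)
  have hR := one_sub_mul_ellGamma hp hq (x := -1) (by norm_num)
  have hne : gammaReg p q (-1) ≠ 0 := by
    refine div_ne_zero (dblPoch_ne_zero hp hq ?_) (gammaReg_denom_ne_zero hp hq (by simp))
    simpa using norm_mul_lt_one hp hq
  have hΓ : ellGamma (-1) p q ≠ 0 := by
    intro h
    rw [h, mul_zero] at hR
    exact hne hR.symm
  rw [inv_neg, inv_one] at hW
  rw [← hW, ← hR]
  field_simp
  norm_num

/-- The integrand with two parameters `± i ρ`, stripped of the poles which pinch the circle at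
`z = ± i` as `ρ → 1`. -/
noncomputable def pinchedIntegrand (p q d x y c : ℂ) (ρ : ℝ) (z : ℂ) : ℂ :=
  gammaReg p q (Complex.I * ρ * z) * gammaReg p q (Complex.I * ρ * z⁻¹) *
    gammaReg p q (-(Complex.I * ρ) * z) * gammaReg p q (-(Complex.I * ρ) * z⁻¹) *
    (gammaPair p q d z * gammaPair p q x z * gammaPair p q y z *
      gammaPair p q (c / (ρ : ℂ) ^ 2) z) * thetaWeight p q z

/-- On the circle the four factors 1 ∓ iρz and 1 ∓ iρ/z multiply to |1 + ρ²z²|², the denominator of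
the Poisson kernel. Pinching at ±i rather than ±1 keeps θ(z²) away from its zeros. -/
theorem ellBetaIntegrand_pinched (hp : ‖p‖ < 1) (hq : ‖q‖ < 1) {d x y c : ℂ} {ρ : ℝ}
    (h0 : 0 < ρ) (h1 : ρ < 1) {z : ℂ} (hz : ‖z‖ = 1) :
    (1 - (ρ : ℂ) ^ 4) *
      ellBetaIntegrand ![Complex.I * ρ, -(Complex.I * ρ), d, x, y, c / (ρ : ℂ) ^ 2] p q z =
      pinchedIntegrand p q d x y c ρ z * (sqPoisson ρ z : ℂ) := by
  have hn : ∀ w : ℂ, ‖w‖ = 1 → Complex.I * ρ * w ≠ 1 ∧ -(Complex.I * ρ) * w ≠ 1 := by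
    intro w hw
    have : ‖Complex.I * ρ * w‖ < 1 := by simpa [hw, abs_of_pos h0] using h1
    constructor <;> intro h
    · simp [h] at this
    · rw [neg_mul, neg_eq_iff_eq_neg] at h
      simp [h] at this
  have hzi : ‖z⁻¹‖ = 1 := by simp [hz]
  have n1 := one_add_sq_mul_sq_ne_zero h0 h1 hz.le
  have n2 := one_add_sq_mul_sq_ne_zero h0 h1 hzi.le
  have f1 : ∀ w : ℂ, (1 - Complex.I * ρ * w) * (1 - -(Complex.I * ρ) * w) =
      1 + (ρ : ℂ) ^ 2 * w ^ 2 := fun w => by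
    linear_combination (-(ρ : ℂ) ^ 2 * w ^ 2) * Complex.I_sq
  rw [ellBetaIntegrand_eq hp hq _ hz, pinchedIntegrand, ofReal_sqPoisson ρ hz,
    ← one_sub_mul_ellGamma hp hq (hn z hz).1, ← one_sub_mul_ellGamma hp hq (hn z hz).2,
    ← one_sub_mul_ellGamma hp hq (hn _ hzi).1, ← one_sub_mul_ellGamma hp hq (hn _ hzi).2,
    mul_div_assoc', eq_div_iff (mul_ne_zero n1 n2), ← f1, ← f1]
  simp only [Fin.prod_univ_six, Matrix.cons_val]
  rw [gammaPair, gammaPair]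
  ring

theorem continuousOn_pinchedIntegrand (hp : ‖p‖ < 1) (hq : ‖q‖ < 1) {d x y c : ℂ} (hd0 : d ≠ 0)
    (hx0 : x ≠ 0) (hy0 : y ≠ 0) (hc0 : c ≠ 0) (hd : ‖d‖ < 1) (hx : ‖x‖ < 1) (hy : ‖y‖ < 1)
    {ρ₀ : ℝ} (h0 : 0 < ρ₀) (hc : ‖c‖ < ρ₀ ^ 2) :
    ContinuousOn (Function.uncurry (pinchedIntegrand p q d x y c))
      (Set.Icc ρ₀ 1 ×ˢ Metric.sphere 0 1) := by
  rintro ⟨ρ, z⟩ ⟨hρ, hz⟩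
  have hz1 : ‖z‖ = 1 := by simpa using hz
  have hz0 := ne_zero_of_norm_eq_one hz1
  have hρ0 : 0 < ρ := h0.trans_le hρ.1
  have hρC : (ρ : ℂ) ≠ 0 := by exact_mod_cast hρ0.ne'
  have hIρ : Complex.I * ρ ≠ 0 := mul_ne_zero Complex.I_ne_zero hρC
  have hcρ : ‖c / (ρ : ℂ) ^ 2‖ < 1 := by
    rw [norm_div, norm_pow, Complex.norm_real, norm_of_nonneg hρ0.le, div_lt_one (by positivity)]
    exact hc.trans_le (pow_le_pow_left₀ h0.le hρ.1 2)
  have cinv : ContinuousAt (fun w : ℝ × ℂ => w.2⁻¹) (ρ, z) := continuousAt_snd.inv₀ hz0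
  have hR : ∀ {g : ℝ × ℂ → ℂ}, ContinuousAt g (ρ, z) → g (ρ, z) ≠ 0 → ‖g (ρ, z)‖ ≤ 1 →
      ContinuousAt (fun w => gammaReg p q (g w)) (ρ, z) := fun hg hg0 hg1 =>
    ContinuousAt.comp (f := _) (continuousAt_gammaReg hp hq hg0 hg1) hg
  have hΓ : ∀ {g : ℝ × ℂ → ℂ}, ContinuousAt g (ρ, z) → g (ρ, z) ≠ 0 → ‖g (ρ, z)‖ < 1 →
      ContinuousAt (fun w => ellGamma (g w) p q) (ρ, z) := fun hg hg0 hg1 =>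
    ContinuousAt.comp (f := _) (differentiableAt_ellGamma hp hq hg0 hg1).continuousAt hg
  have hΓ2 : ∀ {g : ℝ × ℂ → ℂ}, ContinuousAt g (ρ, z) → g (ρ, z) ≠ 0 → ‖g (ρ, z)‖ < 1 →
      ContinuousAt (fun w => gammaPair p q (g w) w.2) (ρ, z) := fun hg hg0 hg1 =>
    (hΓ (hg.mul continuousAt_snd) (mul_ne_zero hg0 hz0) (by simpa [hz1] using hg1)).mul
      (hΓ (hg.mul cinv) (mul_ne_zero hg0 (inv_ne_zero hz0)) (by simpa [hz1] using hg1))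
  have cρ : ContinuousAt (fun w : ℝ × ℂ => (w.1 : ℂ)) (ρ, z) :=
    Complex.continuous_ofReal.continuousAt.comp continuousAt_fst
  have cI : ContinuousAt (fun w : ℝ × ℂ => Complex.I * (w.1 : ℂ)) (ρ, z) :=
    continuousAt_const.mul cρ
  have hle : ρ ≤ 1 := hρ.2
  refine ContinuousAt.continuousWithinAt (ContinuousAt.mul (ContinuousAt.mul (ContinuousAt.mul
    (ContinuousAt.mul (ContinuousAt.mul ?_ ?_) ?_) ?_) (ContinuousAt.mul (ContinuousAt.mul
    (ContinuousAt.mul ?_ ?_) ?_) ?_)) ?_)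
  · exact hR (cI.mul continuousAt_snd) (mul_ne_zero hIρ hz0)
      (by simpa [hz1, abs_of_pos hρ0] using hle)
  · exact hR (cI.mul cinv) (mul_ne_zero hIρ (inv_ne_zero hz0))
      (by simpa [hz1, abs_of_pos hρ0] using hle)
  · exact hR (cI.neg.mul continuousAt_snd) (mul_ne_zero (neg_ne_zero.2 hIρ) hz0)
      (by simpa [hz1, abs_of_pos hρ0] using hle)
  · exact hR (cI.neg.mul cinv) (mul_ne_zero (neg_ne_zero.2 hIρ) (inv_ne_zero hz0))
      (by simpa [hz1, abs_of_pos hρ0] using hle)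
  · exact hΓ2 continuousAt_const hd0 hd
  · exact hΓ2 continuousAt_const hx0 hx
  · exact hΓ2 continuousAt_const hy0 hy
  · exact hΓ2 (continuousAt_const.div (cρ.pow 2) (pow_ne_zero 2 hρC))
      (div_ne_zero hc0 (pow_ne_zero 2 hρC)) hcρ
  · exact ContinuousAt.comp (f := fun w : ℝ × ℂ => w.2) (x := (ρ, z))
      (differentiableAt_thetaWeight hp hq hz0).continuousAt continuousAt_snd

/-- The product `Γ(i d) Γ(- i d) ⋯ Γ(i c) Γ(- i c)`. -/
noncomputable def gammaQuad (p q d x y c : ℂ) : ℂ :=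
  gammaPair p q d Complex.I * gammaPair p q x Complex.I * gammaPair p q y Complex.I *
    gammaPair p q c Complex.I

theorem pinchedIntegrand_one (hp : ‖p‖ < 1) (hq : ‖q‖ < 1) (d x y c : ℂ) :
    pinchedIntegrand p q d x y c 1 Complex.I = 4 * gammaReg p q 1 ^ 2 * gammaQuad p q d x y c ∧
    pinchedIntegrand p q d x y c 1 (-Complex.I) =
      4 * gammaReg p q 1 ^ 2 * gammaQuad p q d x y c := by
  have h4 := gammaReg_neg_one_sq_mul hp hq
  have hinv : -Complex.I = Complex.I⁻¹ := by simp
  have hW : thetaWeight p q Complex.I = qTheta p (-1) * qTheta q (-1) := by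
    simp [thetaWeight]
  have hW' : thetaWeight p q (-Complex.I) = qTheta p (-1) * qTheta q (-1) := by
    simp [thetaWeight]
  have hG : ∀ a, gammaPair p q a (-Complex.I) = gammaPair p q a Complex.I := fun a => by
    rw [hinv, gammaPair_inv]
  constructor
  · rw [pinchedIntegrand, hW]
    simp only [Complex.ofReal_one, mul_one, one_pow, div_one, Complex.inv_I, mul_neg, neg_mul,
      Complex.I_mul_I, neg_neg]
    rw [← h4, gammaQuad]
    ring
  · rw [pinchedIntegrand, hW']
    simp only [hG, Complex.ofReal_one, mul_one, one_pow, div_one, inv_neg, Complex.inv_I, mul_neg,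
      neg_mul, Complex.I_mul_I, neg_neg]
    rw [← h4, gammaQuad]
    ring

/-- Multiply numerator and denominator by 1 - ρ^4. The numerator tends to 4g²Q and the denominator,
in which (1 - ρ²)Γ(ρ²) is regular, to 2gQ, where g is `gammaReg` at 1 and Q is `gammaQuad`. The
quotient 2g is the stated value. -/
theorem tendsto_betaRatio_pinched (hp : ‖p‖ < 1) (hq : ‖q‖ < 1) (hp0 : p ≠ 0) (hq0 : q ≠ 0)
    {d x y c : ℂ} (hd : ‖d‖ < 1) (hx : ‖x‖ < 1) (hy : ‖y‖ < 1) (hc : ‖c‖ < 1)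
    (hprod : d * x * y * c = p * q) :
    Tendsto (fun ρ : ℝ => betaRatio p q
        ![Complex.I * ρ, -(Complex.I * ρ), d, x, y, c / (ρ : ℂ) ^ 2]) (𝓝[<] 1)
      (𝓝 (2 / (qPochInf p p * qPochInf q q))) := by
  have hpq := mul_ne_zero hp0 hq0
  have hne : d * x * y * c ≠ 0 := hprod ▸ hpq
  simp only [mul_ne_zero_iff] at hne
  obtain ⟨⟨⟨hd0, hx0⟩, hy0⟩, hc0⟩ := hne
  have N := fun {x y : ℂ} => norm_mul_lt_one (x := x) (y := y)
  -- This ρ₀ keeps the parameter c/ρ² inside the unit disc for all ρ in [ρ₀, 1].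
  obtain ⟨ρ₀, hρ₀, hρ₀1, hcρ⟩ : ∃ ρ₀ : ℝ, 0 < ρ₀ ∧ ρ₀ < 1 ∧ ‖c‖ < ρ₀ ^ 2 := by
    obtain ⟨r, hr, hr1⟩ := exists_between
      (show √‖c‖ < 1 from (Real.sqrt_lt' one_pos).2 (by simpa using hc))
    refine ⟨r, (Real.sqrt_nonneg _).trans_lt hr, hr1, ?_⟩
    exact (Real.sqrt_lt' ((Real.sqrt_nonneg _).trans_lt hr)).1 hr
  obtain ⟨hI, hI'⟩ := pinchedIntegrand_one hp hq d x y c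
  have hnum := tendsto_circleAverage_mul_sqPoisson hρ₀ hρ₀1
    (continuousOn_pinchedIntegrand hp hq hd0 hx0 hy0 hc0 hd hx hy hρ₀ hcρ) hI hI'
  -- All factors of the gamma product except the singular Γ(ρ²).
  set rest : ℝ → ℂ := fun ρ =>
    ellGamma (Complex.I * ρ * d) p q * ellGamma (Complex.I * ρ * x) p q *
      ellGamma (Complex.I * ρ * y) p q * ellGamma (Complex.I * ρ * (c / (ρ : ℂ) ^ 2)) p q *
      (ellGamma (-(Complex.I * ρ) * (c / (ρ : ℂ) ^ 2)) p q *
        ellGamma (d * (c / (ρ : ℂ) ^ 2)) p q * ellGamma (x * (c / (ρ : ℂ) ^ 2)) p q *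
        ellGamma (y * (c / (ρ : ℂ) ^ 2)) p q) *
      (ellGamma (-(Complex.I * ρ) * d) p q * ellGamma (-(Complex.I * ρ) * x) p q *
        ellGamma (-(Complex.I * ρ) * y) p q *
        ellGamma (d * x) p q * ellGamma (d * y) p q * ellGamma (x * y) p q) with hrest
  have hrest1 : rest 1 = gammaQuad p q d x y c := by
    -- Since dxyc = pq, reflection cancels the six factors not involving ±iρ in pairs.
    have e1 := ellGamma_mul_ellGamma_div hp hq hp0 hq0 (N hd hx)
      (by rw [← hprod, show d * x * y * c / (d * x) = y * c by field_simp]; exact N hy hc)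
    have e2 := ellGamma_mul_ellGamma_div hp hq hp0 hq0 (N hd hy)
      (by rw [← hprod, show d * x * y * c / (d * y) = x * c by field_simp]; exact N hx hc)
    have e3 := ellGamma_mul_ellGamma_div hp hq hp0 hq0 (N hx hy)
      (by rw [← hprod, show d * x * y * c / (x * y) = d * c by field_simp]; exact N hd hc)
    rw [← hprod, show d * x * y * c / (d * x) = y * c by field_simp] at e1
    rw [← hprod, show d * x * y * c / (d * y) = x * c by field_simp] at e2
    rw [← hprod, show d * x * y * c / (x * y) = d * c by field_simp] at e3
    calc rest 1 = gammaQuad p q d x y c * (ellGamma (d * x) p q * ellGamma (y * c) p q) *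
          (ellGamma (d * y) p q * ellGamma (x * c) p q) *
          (ellGamma (x * y) p q * ellGamma (d * c) p q) := by
          simp only [hrest, gammaQuad, gammaPair, Complex.ofReal_one, one_pow, div_one, one_mul,
            Complex.inv_I, mul_neg, neg_mul, mul_comm Complex.I]
          ring
      _ = gammaQuad p q d x y c := by rw [e1, e2, e3]; ring
  have hquad : gammaQuad p q d x y c ≠ 0 := by
    have h : ∀ {v w : ℂ}, v * w = p * q → ‖v‖ < 1 → ‖w‖ < 1 → gammaPair p q v Complex.I ≠ 0 := by
      intro v w hvw hv hw
      have hv0 : v ≠ 0 := left_ne_zero_of_mul (hvw ▸ hpq)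
      have hw' : ‖v * w‖ / ‖v‖ < 1 := by
        rwa [norm_mul, mul_div_cancel_left₀ _ (norm_ne_zero_iff.2 hv0)]
      refine mul_ne_zero (ellGamma_ne_zero hp hq ?_ ?_) (ellGamma_ne_zero hp hq ?_ ?_)
      · simpa using hv
      · rw [← hvw, norm_div]
        simpa using hw'
      · simpa using hv
      · rw [← hvw, norm_div]
        simpa using hw'
    exact mul_ne_zero (mul_ne_zero (mul_ne_zero
      (h (w := x * y * c) (by rw [← hprod]; ring) hd (N (N hx hy) hc))
      (h (w := d * y * c) (by rw [← hprod]; ring) hx (N (N hd hy) hc)))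
      (h (w := d * x * c) (by rw [← hprod]; ring) hy (N (N hd hx) hc)))
      (h (w := d * x * y) (by rw [← hprod]; ring) hc (N (N hd hx) hy))
  have hrestc : ContinuousAt rest 1 := by
    have hΓ : ∀ {g : ℝ → ℂ}, ContinuousAt g 1 → g 1 ≠ 0 → ‖g 1‖ < 1 →
        ContinuousAt (fun ρ => ellGamma (g ρ) p q) 1 := fun hg hg0 hg1 =>
      ContinuousAt.comp (f := _) (differentiableAt_ellGamma hp hq hg0 hg1).continuousAt hg
    have cI : ContinuousAt (fun ρ : ℝ => Complex.I * (ρ : ℂ)) 1 := by fun_prop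
    have cc : ContinuousAt (fun ρ : ℝ => c / (ρ : ℂ) ^ 2) 1 :=
      continuousAt_const.div (by fun_prop) (by simp)
    have hm : ∀ {g h : ℝ → ℂ}, ContinuousAt g 1 → ContinuousAt h 1 → g 1 ≠ 0 → h 1 ≠ 0 →
        ‖g 1‖ * ‖h 1‖ < 1 → ContinuousAt (fun ρ => ellGamma (g ρ * h ρ) p q) 1 :=
      fun hg hh hg0 hh0 h1 => hΓ (hg.mul hh) (mul_ne_zero hg0 hh0) (by rwa [norm_mul])
    have k : ∀ v : ℂ, ContinuousAt (fun _ : ℝ => v) 1 := fun v => continuousAt_const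
    have nn : ∀ {v w : ℂ}, ‖v‖ < 1 → ‖w‖ < 1 → ‖v‖ * ‖w‖ < 1 := fun hv hw => by
      rw [← norm_mul]; exact N hv hw
    refine ((((hm cI (k d) ?_ ?_ ?_).mul (hm cI (k x) ?_ ?_ ?_)).mul
      (hm cI (k y) ?_ ?_ ?_)).mul (hm cI cc ?_ ?_ ?_)).mul
      ((((hm cI.neg cc ?_ ?_ ?_).mul (hm (k d) cc ?_ ?_ ?_)).mul
      (hm (k x) cc ?_ ?_ ?_)).mul (hm (k y) cc ?_ ?_ ?_)) |>.mul
      ((((((hm cI.neg (k d) ?_ ?_ ?_).mul (hm cI.neg (k x) ?_ ?_ ?_)).mul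
      (hm cI.neg (k y) ?_ ?_ ?_)).mul (hm (k d) (k x) ?_ ?_ ?_)).mul
      (hm (k d) (k y) ?_ ?_ ?_)).mul (hm (k x) (k y) ?_ ?_ ?_))
    all_goals simp [hd0, hx0, hy0, hc0, hd, hx, hy, hc, nn]
  have hden : Tendsto (fun ρ : ℝ => (1 + (ρ : ℂ) ^ 2) * gammaReg p q ((ρ : ℂ) ^ 2) * rest ρ)
      (𝓝[<] 1) (𝓝 ((1 + ((1 : ℝ) : ℂ) ^ 2) * gammaReg p q (((1 : ℝ) : ℂ) ^ 2) * rest 1)) := by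
    refine Tendsto.mono_left (ContinuousAt.tendsto ?_) nhdsWithin_le_nhds
    refine ContinuousAt.mul (ContinuousAt.mul (by fun_prop) ?_) hrestc
    exact ContinuousAt.comp (f := fun ρ : ℝ => (ρ : ℂ) ^ 2)
      (continuousAt_gammaReg hp hq (by simp) (by simp)) (by fun_prop)
  have hg1 := gammaReg_one_ne_zero hp hq
  have hlim := hnum.div hden (by
    rw [hrest1]
    simp only [Complex.ofReal_one, one_pow]
    exact mul_ne_zero (mul_ne_zero (by norm_num) hg1) hquad)
  have hval : 4 * gammaReg p q 1 ^ 2 * gammaQuad p q d x y c /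
      ((1 + ((1 : ℝ) : ℂ) ^ 2) * gammaReg p q (((1 : ℝ) : ℂ) ^ 2) * rest 1) =
      2 / (qPochInf p p * qPochInf q q) := by
    rw [hrest1, div_eq_mul_inv 2, ← gammaReg_one hp hq]
    simp only [Complex.ofReal_one, one_pow]
    field_simp
    norm_num
  rw [hval] at hlim
  refine hlim.congr' ?_
  filter_upwards [Ioo_mem_nhdsLT (zero_lt_one (α := ℝ))] with ρ hρ
  have hρ2 : (ρ : ℂ) ^ 2 ≠ 1 := by
    norm_cast
    exact (pow_lt_one₀ hρ.1.le hρ.2 two_ne_zero).ne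
  have hρ2' : (1 : ℂ) - (ρ : ℂ) ^ 2 ≠ 0 := sub_ne_zero.2 hρ2.symm
  have havg : circleAverage (fun z => pinchedIntegrand p q d x y c ρ z * (sqPoisson ρ z : ℂ)) 0 1 =
      (1 - (ρ : ℂ) ^ 4) * circleAverage (ellBetaIntegrand
        ![Complex.I * ρ, -(Complex.I * ρ), d, x, y, c / (ρ : ℂ) ^ 2] p q) 0 1 := by
    rw [← smul_eq_mul, ← circleAverage_smul]
    exact circleAverage_congr_sphere fun z hz =>
      (ellBetaIntegrand_pinched hp hq hρ.1 hρ.2 (by simpa using hz)).symm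
  have hΓ : gammaReg p q ((ρ : ℂ) ^ 2) =
      (1 - (ρ : ℂ) ^ 2) * ellGamma (Complex.I * ρ * -(Complex.I * ρ)) p q := by
    rw [← one_sub_mul_ellGamma hp hq hρ2]
    congr 2
    linear_combination (ρ : ℂ) ^ 2 * Complex.I_sq
  simp only [Pi.div_apply]
  have hρ3 : (1 : ℂ) + (ρ : ℂ) ^ 2 ≠ 0 := by
    norm_cast
    positivity
  rw [havg, hΓ, betaRatio, gammaPairProd_vec, show (1 : ℂ) - (ρ : ℂ) ^ 4 =
    (1 - (ρ : ℂ) ^ 2) * (1 + (ρ : ℂ) ^ 2) by ring,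
    ← mul_div_mul_left _ (_ * _ * _ * _) (mul_ne_zero hρ2' hρ3)]
  congr 1
  simp only [hrest]
  ring

end Regularized

/-! ### Evaluation of the ratio, then continuation to all parameters. -/

section Evaluation

variable {p q : ℂ}

theorem betaRatio_slice (hp : ‖p‖ < 1) (hq : ‖q‖ < 1) (hp0 : p ≠ 0) (hq0 : q ≠ 0)
    {b d x y c : ℂ} (hb : ‖b‖ < 1) (hd : ‖d‖ < 1) (hx : ‖x‖ < 1) (hy : ‖y‖ < 1)
    (hprod : b * d * x * y * c = p * q) (hc : ‖c‖ < ‖q‖) {s₁ s₂ : ℂ}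
    (h₁ : ‖q‖ ≤ ‖s₁‖) (h₁' : ‖s₁‖ < 1) (h₂ : ‖q‖ ≤ ‖s₂‖) (h₂' : ‖s₂‖ < 1) :
    betaRatio p q ![s₁, b, d, x, y, c / s₁] = betaRatio p q ![s₂, b, d, x, y, c / s₂] := by
  have hqp : 0 < ‖q‖ := norm_pos_iff.2 hq0
  -- r > |q| and r|q| > |c| put the closed fundamental domain r|q| ≤ |s| ≤ r inside the domain of
  -- holomorphy; r < 1 makes |q| ≤ |s| lie beyond its inner edge.
  obtain ⟨r, hr, hr1⟩ := exists_between (max_lt hq ((div_lt_one hqp).2 hc))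
  have hqr : ‖q‖ < r := (le_max_left _ _).trans_lt hr
  have hcr : ‖c‖ < r * ‖q‖ := (div_lt_iff₀ hqp).1 ((le_max_right _ _).trans_lt hr)
  have hrq : r * ‖q‖ < ‖q‖ := mul_lt_of_lt_one_left hqp hr1
  have hne : ∀ s : ℂ, ‖c‖ < ‖s‖ → s ≠ 0 := fun s hs =>
    norm_pos_iff.1 ((norm_nonneg c).trans_lt hs)
  have hcs : ∀ s : ℂ, ‖c‖ < ‖s‖ → ‖c / s‖ < 1 := fun s hs => by
    rw [norm_div]
    exact (div_lt_one ((norm_nonneg c).trans_lt hs)).2 hs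
  refine eq_of_mul_periodic (F := fun s => betaRatio p q ![s, b, d, x, y, c / s]) (a := ‖c‖)
    hq0 ?_ ?_ hqr.le hr1 hcr ⟨hrq.trans_le h₁, h₁'⟩ ⟨hrq.trans_le h₂, h₂'⟩
  · have hV : IsOpen {s : ℂ | ‖c‖ < ‖s‖ ∧ ‖s‖ < 1} :=
      (isOpen_lt continuous_const continuous_norm).inter
        (isOpen_lt continuous_norm continuous_const)
    refine differentiableOn_betaRatio hp hq hp0 hq0 hV ?_ fun s hs =>
      ⟨forall_vecSix (P := fun w => ‖w‖ < 1) hs.2 hb hd hx hy (hcs s hs.1), ?_⟩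
    · have hlast : DifferentiableOn ℂ (fun s => c / s) {s : ℂ | ‖c‖ < ‖s‖ ∧ ‖s‖ < 1} :=
        fun s hs => ((differentiableAt_const c).div differentiableAt_id
          (hne s hs.1)).differentiableWithinAt
      intro k
      fin_cases k
      exacts [differentiableOn_id, differentiableOn_const b, differentiableOn_const d,
        differentiableOn_const x, differentiableOn_const y, hlast]
    · have hs0 := hne s hs.1
      simp only [Fin.prod_univ_six, Matrix.cons_val]
      rw [← hprod]
      field_simp
  · intro s hs hs1
    have hqs0 := hne _ hs
    have hs0 : s ≠ 0 := right_ne_zero_of_mul hqs0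
    have key := betaRatio_shift (a := s) (u := c / (q * s)) hp hq hp0 hq0 hs1 hb hd hx hy
      (hcs _ hs) (by
        have : s * b * d * x * y * (c / (q * s)) = b * d * x * y * c / q := by field_simp
        rw [this, hprod, mul_div_cancel_right₀ _ hq0])
    rw [show q * (c / (q * s)) = c / s by field_simp] at key
    exact key.symm

/-- Two slices: a moves to iρ and then b to -iρ, the last parameter absorbing the change. |a| ≤ ρ
keeps that parameter small enough for the second slice. -/
theorem betaRatio_eq_pinched (hp : ‖p‖ < 1) (hq : ‖q‖ < 1) (hp0 : p ≠ 0) (hq0 : q ≠ 0)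
    {a b d x y u : ℂ} (ha : ‖a‖ < 1) (hb : ‖b‖ < 1) (hd : ‖d‖ < 1) (hx : ‖x‖ < 1) (hy : ‖y‖ < 1)
    (hprod : a * b * d * x * y * u = p * q) (hu : ‖u‖ < ‖q‖) (hqa : ‖q‖ ≤ ‖a‖) (hqb : ‖q‖ ≤ ‖b‖)
    {ρ : ℝ} (haρ : ‖a‖ ≤ ρ) (hρ : ρ < 1) :
    betaRatio p q ![a, b, d, x, y, u] = betaRatio p q
      ![Complex.I * ρ, -(Complex.I * ρ), d, x, y, a * b * u / (ρ : ℂ) ^ 2] := by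
  have hqp : 0 < ‖q‖ := norm_pos_iff.2 hq0
  have hρ0 : 0 < ρ := (hqp.trans_le hqa).trans_le haρ
  have hρC : (ρ : ℂ) ≠ 0 := by exact_mod_cast hρ0.ne'
  have ha0 : a ≠ 0 := norm_pos_iff.1 (hqp.trans_le hqa)
  have hb0 : b ≠ 0 := norm_pos_iff.1 (hqp.trans_le hqb)
  have hIρ : Complex.I * ρ ≠ 0 := mul_ne_zero Complex.I_ne_zero hρC
  have hnI : ‖Complex.I * ρ‖ = ρ := by simp [abs_of_pos hρ0]
  have hau : ‖a * u‖ < ‖q‖ := by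
    rw [norm_mul]
    exact (mul_le_of_le_one_left (norm_nonneg u) ha.le).trans_lt hu
  have hau' : ‖b * (a * u / (Complex.I * ρ))‖ < ‖q‖ := by
    have h1 : ‖a * u / (Complex.I * ρ)‖ ≤ ‖u‖ := by
      rw [norm_div, hnI, norm_mul, div_le_iff₀ hρ0, mul_comm]
      gcongr
    rw [norm_mul]
    exact ((mul_le_of_le_one_left (norm_nonneg _) hb.le).trans h1).trans_lt hu
  have s1 := betaRatio_slice (c := a * u) hp hq hp0 hq0 hb hd hx hy
    (by rw [← hprod]; ring) hau hqa ha (s₂ := Complex.I * ρ)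
    (by rw [hnI]; exact hqa.trans haρ) (by rwa [hnI])
  have s2 := betaRatio_slice (b := Complex.I * ρ) (c := b * (a * u / (Complex.I * ρ)))
    hp hq hp0 hq0 (by rwa [hnI]) hd hx hy (by rw [← hprod]; field_simp) hau' hqb hb
    (s₂ := -(Complex.I * ρ)) (by rw [norm_neg, hnI]; exact hqa.trans haρ) (by rwa [norm_neg, hnI])
  rw [mul_div_cancel_left₀ _ ha0] at s1
  rw [mul_div_cancel_left₀ _ hb0] at s2
  rw [s1, betaRatio_swap, s2, betaRatio_swap]
  congr 2
  have : b * (a * u / (Complex.I * ρ)) / -(Complex.I * ρ) = a * b * u / (ρ : ℂ) ^ 2 := by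
    rw [mul_div_assoc', div_div, show Complex.I * ρ * -(Complex.I * ρ) = (ρ : ℂ) ^ 2 by
      linear_combination (-(ρ : ℂ) ^ 2) * Complex.I_sq]
    ring
  rw [this]

/-- The ratio is independent of ρ near 1, so it equals its limit. -/
theorem betaRatio_eq_of_norm_lt (hp : ‖p‖ < 1) (hq : ‖q‖ < 1) (hp0 : p ≠ 0) (hq0 : q ≠ 0)
    {t : Fin 6 → ℂ} (ht : t ∈ betaDomain p q) (h5 : ‖t 5‖ < ‖q‖) (h0 : ‖q‖ ≤ ‖t 0‖)
    (h1 : ‖q‖ ≤ ‖t 1‖) : betaRatio p q t = 2 / (qPochInf p p * qPochInf q q) := by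
  have hvec : t = ![t 0, t 1, t 2, t 3, t 4, t 5] := by
    funext k
    fin_cases k <;> rfl
  have hprod := ht.2
  rw [Fin.prod_univ_six] at hprod
  have hlim := tendsto_betaRatio_pinched hp hq hp0 hq0 (c := t 0 * t 1 * t 5) (ht.1 2) (ht.1 3)
    (ht.1 4) (norm_mul_lt_one (norm_mul_lt_one (ht.1 0) (ht.1 1)) (ht.1 5))
    (by rw [← hprod]; ring)
  refine tendsto_nhds_unique (Tendsto.congr' ?_ tendsto_const_nhds) hlim
  filter_upwards [Ioo_mem_nhdsLT (ht.1 0)] with ρ hρ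
  conv_lhs => rw [hvec]
  exact betaRatio_eq_pinched hp hq hp0 hq0 (ht.1 0) (ht.1 1) (ht.1 2) (ht.1 3) (ht.1 4) hprod h5
    h0 h1 hρ.1.le hρ.2

/-- Logarithmic coordinates of a path from `exp ∘ u` to `exp ∘ v`. -/
noncomputable def expPath (u v : Fin 6 → ℂ) (s : ℂ) (k : Fin 6) : ℂ :=
  Complex.exp ((1 - s) * u k + s * v k)

theorem betaRatio_eq (hp : ‖p‖ < 1) (hq : ‖q‖ < 1) (hp0 : p ≠ 0) (hq0 : q ≠ 0)
    {t : Fin 6 → ℂ} (ht : t ∈ betaDomain p q) :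
    betaRatio p q t = 2 / (qPochInf p p * qPochInf q q) := by
  have hpq := mul_ne_zero hp0 hq0
  have ht0 := ne_zero_of_prod_eq hpq ht.2
  -- The target point has five coordinates e^{-δ} and the sixth pq e^{5δ}; these bounds place it
  -- strictly inside the region of `betaRatio_eq_of_norm_lt`.
  obtain ⟨δ, hδ0, hδp, hδq⟩ : ∃ δ : ℝ, 0 < δ ∧ ‖p‖ * Real.exp (5 * δ) < 1 ∧
      ‖q‖ < Real.exp (-δ) := by
    have h1 : Tendsto (fun δ : ℝ => ‖p‖ * Real.exp (5 * δ)) (𝓝[>] 0)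
        (𝓝 (‖p‖ * Real.exp (5 * 0))) :=
      (Continuous.tendsto (by fun_prop) 0).mono_left nhdsWithin_le_nhds
    have h2 : Tendsto (fun δ : ℝ => Real.exp (-δ)) (𝓝[>] 0) (𝓝 (Real.exp (-0))) :=
      (Continuous.tendsto (by fun_prop) 0).mono_left nhdsWithin_le_nhds
    obtain ⟨δ, h⟩ := ((eventually_mem_nhdsWithin (a := (0 : ℝ)) (s := Set.Ioi 0)).and
      ((h1.eventually_lt_const (by simpa using hp)).and
        (h2.eventually_const_lt (by simpa using hq)))).exists
    exact ⟨δ, h.1, h.2.1, h.2.2⟩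
  set u : Fin 6 → ℂ := fun k => Complex.log (t k) with hu
  set v : Fin 6 → ℂ := ![-δ, -δ, -δ, -δ, -δ, (∑ k, u k) + 5 * δ] with hv
  have hexpu : Complex.exp (∑ k, u k) = p * q := by
    rw [Complex.exp_sum, ← ht.2]
    exact Finset.prod_congr rfl fun k _ => Complex.exp_log (ht0 k)
  have hsum : ∑ k, v k = ∑ k, u k := by
    rw [Fin.sum_univ_six v]
    simp only [hv, Matrix.cons_val]
    ring
  set ℓ : ℂ → Fin 6 → ℂ := fun s k => (1 - s) * u k + s * v k with hℓ
  -- In logarithmic coordinates |t_k| < 1 is a half-plane condition on s, so V is convex, and the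
  -- product constraint is preserved along the whole complex line.
  set V : Set ℂ := {s | ∀ k, (ℓ s k).re < 0} with hV
  have hVo : IsOpen V := by
    rw [hV, Set.ofPred_forall]
    exact isOpen_iInter_of_finite fun k => isOpen_lt (by fun_prop) continuous_const
  have hVc : Convex ℝ V := by
    intro s hs s' hs' a b ha hb hab k
    have e : ℓ (a • s + b • s') k = a • ℓ s k + b • ℓ s' k := by
      have hab' : (a : ℂ) + b = 1 := by exact_mod_cast hab
      simp only [hℓ, Complex.real_smul]
      linear_combination (-u k) * hab'
    rw [e, Complex.add_re, Complex.smul_re, Complex.smul_re]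
    exact (convex_Iio (0 : ℝ)) (hs k) (hs' k) ha hb hab
  have hdom : ∀ s ∈ V, expPath u v s ∈ betaDomain p q := by
    intro s hs
    refine ⟨fun k => ?_, ?_⟩
    · rw [expPath, Complex.norm_exp]
      exact Real.exp_lt_one_iff.2 (hs k)
    · unfold expPath
      rw [← Complex.exp_sum, Finset.sum_add_distrib, ← Finset.mul_sum, ← Finset.mul_sum, hsum,
        ← hexpu]
      congr 1
      ring
  have hdiff : DifferentiableOn ℂ (fun s => betaRatio p q (expPath u v s)) V :=
    differentiableOn_betaRatio hp hq hp0 hq0 hVo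
      (fun k => by unfold expPath; fun_prop) hdom
  have hnorm : ∀ k, ‖Complex.exp (v k)‖ < 1 → (v k).re < 0 := fun k h => by
    rw [Complex.norm_exp] at h
    simpa using h
  have hv5 : ‖Complex.exp (v 5)‖ < ‖q‖ := by
    have : v 5 = (∑ k, u k) + 5 * δ := rfl
    rw [this, Complex.exp_add, hexpu, norm_mul, norm_mul, Complex.norm_exp]
    have e : ((5 : ℂ) * δ).re = 5 * δ := by simp
    rw [e]
    nlinarith [norm_pos_iff.2 hq0]
  have hvδ : ∀ k, k ≠ 5 → v k = -δ := by
    intro k hk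
    fin_cases k <;> first | rfl | exact absurd rfl hk
  have hexpδ : ‖Complex.exp (-δ)‖ = Real.exp (-δ) := by
    rw [Complex.norm_exp]
    simp
  have h1V : (1 : ℂ) ∈ V := by
    intro k
    simp only [hℓ, sub_self, zero_mul, one_mul, zero_add]
    by_cases hk : k = 5
    · subst hk
      exact hnorm 5 (hv5.trans hq)
    · rw [hvδ k hk]
      simpa using hδ0
  have h0V : (0 : ℂ) ∈ V := by
    intro k
    simp only [hℓ, sub_zero, zero_mul, one_mul, add_zero, hu, Complex.log_re]
    exact Real.log_neg (norm_pos_iff.2 (ht0 k)) (ht.1 k)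
  have hcont : ∀ k, Continuous fun s => ‖expPath u v s k‖ := fun k => by
    unfold expPath; fun_prop
  have hone : ∀ k, expPath u v 1 k = Complex.exp (v k) := fun k => by simp [expPath]
  have hev : (fun s => betaRatio p q (expPath u v s)) =ᶠ[𝓝 1]
      fun _ => 2 / (qPochInf p p * qPochInf q q) := by
    have e5 : ∀ᶠ s in 𝓝 (1 : ℂ), ‖expPath u v s 5‖ < ‖q‖ :=
      (hcont 5).continuousAt.eventually_lt_const (by simpa only [hone] using hv5)
    have e0 : ∀ᶠ s in 𝓝 (1 : ℂ), ‖q‖ < ‖expPath u v s 0‖ :=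
      (hcont 0).continuousAt.eventually_const_lt (by
        simpa only [hone, hvδ 0 (by decide), hexpδ] using hδq)
    have e1 : ∀ᶠ s in 𝓝 (1 : ℂ), ‖q‖ < ‖expPath u v s 1‖ :=
      (hcont 1).continuousAt.eventually_const_lt (by
        simpa only [hone, hvδ 1 (by decide), hexpδ] using hδq)
    filter_upwards [hVo.mem_nhds h1V, e5, e0, e1] with s hs h5 h0 h1
    exact betaRatio_eq_of_norm_lt hp hq hp0 hq0 (hdom s hs) h5 h0.le h1.le
  -- The identity theorem carries the value from a neighbourhood of s = 1 to s = 0, the given t.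
  have key := (hdiff.analyticOnNhd hVo).eqOn_of_preconnected_of_eventuallyEq
    (analyticOnNhd_const) hVc.isPreconnected h1V hev h0V
  have hzero : expPath u v 0 = t := by
    funext k
    simp [expPath, hu, Complex.exp_log (ht0 k)]
  simpa only [hzero] using key

end Evaluation

theorem mainTheorem1 (p q : ℂ) (hp0 : p ≠ 0) (hq0 : q ≠ 0) (hp : ‖p‖ < 1) (hq : ‖q‖ < 1)
    (t : Fin 6 → ℂ) (ht : ∀ j, ‖t j‖ < 1) (hprod : ∏ j, t j = p * q) :
    CircleIntegrable (fun z : ℂ => ellBetaIntegrand t p q z / z) 0 1 ∧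
      ellBetaKappa p q * (∮ z in C(0, 1), ellBetaIntegrand t p q z / z) =
        ∏ j : Fin 6, ∏ k ∈ Finset.Ioi j, ellGamma (t j * t k) p q := by
  have htD : t ∈ betaDomain p q := ⟨ht, hprod⟩
  refine ⟨circleIntegrable_ellBetaIntegrand_div hp hq
    (ne_zero_of_prod_eq (mul_ne_zero hp0 hq0) hprod) ht, ?_⟩
  have hratio := betaRatio_eq hp hq hp0 hq0 htD
  have hne := gammaPairProd_ne_zero hp hq hp0 hq0 htD
  have hpp := qPochInf_ne_zero hp hp
  have hqq := qPochInf_ne_zero hq hq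
  have hpi : (π : ℂ) ≠ 0 := by exact_mod_cast pi_ne_zero
  -- The mean value is (2πi)⁻¹ times the integral of f(z)/z, so κ times the integral is (p;p)_∞
  -- (q;q)_∞ / 2 times the mean.
  rw [betaRatio, div_eq_iff hne, circleAverage_eq_circleIntegral one_ne_zero] at hratio
  have hint : (∮ z in C(0, 1), (z - 0)⁻¹ • ellBetaIntegrand t p q z) =
      ∮ z in C(0, 1), ellBetaIntegrand t p q z / z := by
    simp only [sub_zero, smul_eq_mul, inv_mul_eq_div]
  rw [hint, smul_eq_mul] at hratio
  change _ = gammaPairProd p q t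
  rw [ellBetaKappa]
  field_simp at hratio ⊢
  linear_combination hratio
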